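/- Let $A$ be a ring of functions of the multi-time $t=(t_1=x,t_2,t_3,\dots)$, i.e. a commutative $\mathbb Q$-algebra with commuting derivations $\partial_n=\partial/\partial t_n$, $n\ge 1$ (for example formal power series in $t$). Put $\xi(t,z)=\sum_{n\ge1}t_nz^n$ and $[z^{-1}]=(z^{-1},\tfrac12z^{-2},\tfrac13z^{-3},\dots)$, and let $f(t\pm[z^{-1}])=\exp\bigl(\pm\sum_{l\ge1}\tfrac{z^{-l}}{l}\partial_l\bigr)f(t)$ be the formal Taylor expansion. Exponentials $e^{\pm\xi}$ are treated formally, with $\partial_n e^{\pm\xi(t,z)}=\pm z^n e^{\pm\xi(t,z)}$, and all series in the spectral parameters $\lambda,\mu,z$ are expanded in the region $|\mu|<|\lambda|<|z|$. Let $D=\partial_x$, and let $W=1+\sum_{n\ge1}w_n(t)D^{-n}$ be the dressing operator of a solution of the KP hierarchy with Lax operator $L=WD^rW^{-1}$ ($r\ge 1$), so that $L^{n/r}=WD^nW^{-1}$ and the Wilson–Sato equations $\partial_nW=-(L^{n/r})_-W$ hold for all $n\ge1$. Let $\psi_{BA}(t,z)=W(e^{\xi(t,z)})$ and $\psi^*_{BA}(t,z)=(W^*)^{-1}(e^{-\xi(t,z)})$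 be the Baker–Akhiezer function and its adjoint, and let $\tau$, invertible in $A$, be a tau-function of the solution: $$\psi_{BA}(t,z)=\frac{\tau(t-[z^{-1}])}{\tau(t)}e^{\xi(t,z)},\qquad \psi^*_{BA}(t,z)=\frac{\tau(t+[z^{-1}])}{\tau(t)}e^{-\xi(t,z)}.$$ Let $\hat X(\lambda,\mu)$ be the bilocal vertex operator $$\hat X(\lambda,\mu)=\frac1\lambda\,e^{\xi(t+[\lambda^{-1}],\mu)-\xi(t,\lambda)}\exp\Bigl(\sum_{l\ge1}\tfrac1l(\lambda^{-l}-\mu^{-l})\partial_l\Bigr),$$ and define its action on $\psi_{BA}(t,z)$, induced from the variation $\tau\mapsto\hat X(\lambda,\mu)\tau$ of the tau-function, by $$\hat X(\lambda,\mu)\psi_{BA}(t,z)=e^{\xi(t,z)}\,\frac{\tau(t)\,(\hat X(\lambda,\mu)\tau)(t-[z^{-1}])-\tau(t-[z^{-1}])\,(\hat X(\lambda,\mu)\tau)(t)}{\tau(t)^2}.$$ Let $S=S\bigl(\psi_{BA}(t,z),\psi^*_{BA}(t,\lambda)\bigr)$ be the squared eigenfunction potential of $\Phi=\psi_{BA}(t,z)$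 and $\Psi=\psi^*_{BA}(t,\lambda)$, i.e. a solution of $$\partial_nS=\mathrm{Res}\bigl(D^{-1}\,\Psi\,(L^{n/r})_+\,\Phi\,D^{-1}\bigr)\qquad(n\ge1),$$ whose additive constant is normalized by requiring that $S$ be $e^{\xi(t,z)}$ times a formal Laurent series in $z^{-1}$ (finitely many positive powers of $z$), with coefficients that may depend on $t,\lambda,\mu$. Then this $S$ exists and is unique, and $$\hat X(\lambda,\mu)\psi_{BA}(t,z)=\psi_{BA}(t,\mu)\,S\bigl(\psi_{BA}(t,z),\psi^*_{BA}(t,\lambda)\bigr).$$ Moreover both sides equal the action on $\psi_{BA}(t,z)=W(e^{\xi(t,z)})$ of the ghost flow $\partial_{(\lambda,\mu)}W=Y(\lambda,\mu)W$ generated by $Y(\lambda,\mu)=\psi_{BA}(t,\mu)D^{-1}\psi^*_{BA}(t,\lambda)$, that is, $\hat X(\lambda,\mu)\psi_{BA}(t,z)=\bigl(Y(\lambda,\mu)W\bigr)(e^{\xi(t,z)})$. -/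

import Mathlib

noncomputable section

namespace KP

/-! ### Functions of the multi-time -/

/-- A ring of functions of the KP multi-time `t = (t₁ = x, t₂, t₃, …)`: a commutative `ℚ`-algebra
with commuting derivations `flow n = ∂/∂tₙ`, `n ≥ 1` (formal power series in `t`, smooth or
meromorphic functions of `t`, …). -/
class MultiTimeRing (B : Type*) [CommRing B] [Algebra ℚ B] where
  flow : ℕ+ → Derivation ℚ B B
  flow_comm : ∀ (m n : ℕ+) (f : B), flow m (flow n f) = flow n (flow m f)

/-- `∂f/∂tₙ`. -/
abbrev flow {B : Type*} [CommRing B] [Algebra ℚ B] [MultiTimeRing B] (n : ℕ+) :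
    Derivation ℚ B B := MultiTimeRing.flow n

/-! ### Formal series in a spectral parameter, with exponentials

`LaurentSeries B` is used for series in the inverse `z⁻¹` of a spectral parameter: the coefficient
with index `i` is the coefficient of `z⁻ⁱ`, so only finitely many positive powers of `z` occur. -/

section Laurent

variable {B : Type*} [CommRing B] [Algebra ℚ B]

/-- The coefficientwise `ℚ`-algebra structure, given priority over the (equal) one that passes
through power series. -/
instance (priority := 2000) : Algebra ℚ (LaurentSeries B) := HahnSeries.instAlgebra

/-- A derivation of the coefficient ring, acting on Laurent series coefficientwise. -/
def laurentDerivation (d : Derivation ℚ B B) :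
    Derivation ℚ (LaurentSeries B) (LaurentSeries B) :=
  Derivation.mk'
    { toFun := fun f => HahnSeries.map f d
      map_add' := fun f g => by ext i; simp
      map_smul' := fun c f => by ext i; simp } <| by
    intro f g
    ext i
    have hf : (HahnSeries.map f d).support ⊆ f.support := by
      intro j hj hz
      exact hj (by simp [hz])
    have hg : (HahnSeries.map g d).support ⊆ g.support := by
      intro j hj hz
      exact hj (by simp [hz])
    simp only [LinearMap.coe_mk, AddHom.coe_mk, HahnSeries.map_coeff, smul_eq_mul,
      HahnSeries.coeff_add]
    rw [HahnSeries.coeff_mul, HahnSeries.coeff_mul_right' g.isPWO_support hg, mul_comm g,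
      HahnSeries.coeff_mul_left' f.isPWO_support hf, map_sum, ← Finset.sum_add_distrib]
    refine Finset.sum_congr rfl fun p _ => ?_
    simp [mul_comm]

@[simp] theorem laurentDerivation_coeff (d : Derivation ℚ B B) (f : LaurentSeries B) (i : ℤ) :
    (laurentDerivation d f).coeff i = d (f.coeff i) := rfl

/-- The monomial `zᵏ`. -/
def zpow (k : ℤ) : LaurentSeries B := HahnSeries.single (-k) 1

end Laurent

/-- `WaveRing B` is the ring of finite sums `∑ₖ fₖ(z) e^{k ξ(t,z)}`, where `fₖ` is a Laurent series
in `z⁻¹` over `B` and `ξ(t,z) = ∑ₙ tₙ zⁿ`. The exponentials are the group elements of a group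
algebra, so `e^{kξ} e^{lξ} = e^{(k+l)ξ}`. -/
def WaveRing (B : Type*) [CommRing B] : Type _ := AddMonoidAlgebra (LaurentSeries B) ℤ

namespace WaveRing

variable {B : Type*} [CommRing B]

instance : CommRing (WaveRing B) :=
  inferInstanceAs (CommRing (AddMonoidAlgebra (LaurentSeries B) ℤ))

instance [Algebra ℚ B] : Algebra ℚ (WaveRing B) :=
  inferInstanceAs (Algebra ℚ (AddMonoidAlgebra (LaurentSeries B) ℤ))

/-- The element `f(z) e^{k ξ(t,z)}`. -/
def term (k : ℤ) (f : LaurentSeries B) : WaveRing B := AddMonoidAlgebra.single k f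

/-- The coefficient `fₖ(z)` of `e^{k ξ(t,z)}`. -/
def part (p : WaveRing B) (k : ℤ) : LaurentSeries B := AddMonoidAlgebra.coeff p k

@[ext] theorem ext {p q : WaveRing B} (h : ∀ k, p.part k = q.part k) : p = q :=
  AddMonoidAlgebra.ext (Finsupp.ext h)

theorem part_add (p q : WaveRing B) (k : ℤ) : (p + q).part k = p.part k + q.part k := rfl

theorem part_smul [Algebra ℚ B] (c : ℚ) (p : WaveRing B) (k : ℤ) :
    (c • p).part k = c • p.part k := rfl

theorem part_term (k l : ℤ) (f : LaurentSeries B) :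
    (term k f).part l = if k = l then f else 0 := by
  classical
  exact Finsupp.single_apply

theorem term_mul_term (k l : ℤ) (f g : LaurentSeries B) :
    term k f * term l g = term (k + l) (f * g) :=
  AddMonoidAlgebra.single_mul_single ..

theorem induction_on {motive : WaveRing B → Prop} (p : WaveRing B) (zero : motive 0)
    (add : ∀ p q, motive p → motive q → motive (p + q))
    (term : ∀ k f, motive (term k f)) : motive p :=
  AddMonoidAlgebra.induction_linear p zero (fun p q => add p q) term

/-- An element of `B`, as an element not depending on the spectral parameter. -/
def const : B →+* WaveRing B :=
  (AddMonoidAlgebra.singleZeroRingHom : LaurentSeries B →+* AddMonoidAlgebra (LaurentSeries B) ℤ).comp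
    (HahnSeries.C : B →+* LaurentSeries B)

/-- The exponential `e^{k ξ(t,z)}`. -/
def expXi (k : ℤ) : WaveRing B := term k 1

/-- The power `zᵏ` of the spectral parameter. -/
def spec (k : ℤ) : WaveRing B := term 0 (zpow k)

variable [Algebra ℚ B]

/-- The extension of a derivation `d = ∂/∂tₙ` of `B` to `WaveRing B`, with
`∂/∂tₙ (f(z) e^{kξ(t,z)}) = (∂f/∂tₙ + k zⁿ f) e^{kξ(t,z)}`. -/
def flowLinear (d : Derivation ℚ B B) (n : ℕ+) : WaveRing B →ₗ[ℚ] WaveRing B where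
  toFun p := AddMonoidAlgebra.ofCoeff <|
    Finsupp.onFinset (AddMonoidAlgebra.coeff p).support
      (fun k => laurentDerivation d (p.part k) + k • (zpow (n : ℤ) * p.part k)) (by
        intro k hk
        rw [Finsupp.mem_support_iff]
        intro h
        have h' : p.part k = 0 := h
        exact hk (by simp [h']))
  map_add' p q := by
    ext1 k
    change laurentDerivation d ((p + q).part k) + k • (zpow (n : ℤ) * (p + q).part k) =
      (laurentDerivation d (p.part k) + k • (zpow (n : ℤ) * p.part k)) +
        (laurentDerivation d (q.part k) + k • (zpow (n : ℤ) * q.part k))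
    rw [part_add, map_add, mul_add, smul_add]
    abel
  map_smul' c p := by
    ext1 k
    change laurentDerivation d ((c • p).part k) + k • (zpow (n : ℤ) * (c • p).part k) =
      c • (laurentDerivation d (p.part k) + k • (zpow (n : ℤ) * p.part k))
    rw [part_smul, Derivation.map_smul, smul_add, mul_smul_comm, smul_comm k c]

theorem flowLinear_part (d : Derivation ℚ B B) (n : ℕ+) (p : WaveRing B) (k : ℤ) :
    (flowLinear d n p).part k = laurentDerivation d (p.part k) + k • (zpow (n : ℤ) * p.part k) :=
  rfl

theorem flowLinear_term (d : Derivation ℚ B B) (n : ℕ+) (k : ℤ) (f : LaurentSeries B) :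
    flowLinear d n (term k f) = term k (laurentDerivation d f + k • (zpow (n : ℤ) * f)) := by
  ext1 l
  rw [flowLinear_part, part_term, part_term]
  split_ifs with h
  · rw [h]
  · simp

/-- `flowLinear` as a derivation. -/
def flowDerivation (d : Derivation ℚ B B) (n : ℕ+) : Derivation ℚ (WaveRing B) (WaveRing B) :=
  Derivation.mk' (flowLinear d n) <| by
    intro p q
    induction p using induction_on with
    | zero => simp
    | add p₁ p₂ h₁ h₂ =>
      simp only [smul_eq_mul, add_mul, map_add, mul_add] at h₁ h₂ ⊢
      rw [h₁, h₂]
      abel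
    | term k f =>
      induction q using induction_on with
      | zero => simp
      | add q₁ q₂ h₁ h₂ =>
        simp only [smul_eq_mul, add_mul, map_add, mul_add] at h₁ h₂ ⊢
        rw [h₁, h₂]
        abel
      | term l g =>
        have hadd : ∀ (m : ℤ) (a b : LaurentSeries B), term m a + term m b = term m (a + b) :=
          fun m a b => (AddMonoidAlgebra.single_add m a b).symm
        rw [term_mul_term, flowLinear_term, flowLinear_term, flowLinear_term, smul_eq_mul,
          smul_eq_mul, term_mul_term, term_mul_term, add_comm l k, hadd, Derivation.leibniz]
        congr 1
        simp only [smul_eq_mul, zsmul_eq_mul, Int.cast_add]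
        ring

instance [MultiTimeRing B] : MultiTimeRing (WaveRing B) where
  flow n := flowDerivation (flow n) n
  flow_comm m n p := by
    have hz : ∀ (d : Derivation ℚ B B) (j : ℤ), laurentDerivation d (zpow j) = 0 := by
      intro d j
      ext i
      rw [laurentDerivation_coeff, zpow, HahnSeries.coeff_single]
      split_ifs <;> simp
    have hc : ∀ f : LaurentSeries B, laurentDerivation (flow m) (laurentDerivation (flow n) f) =
        laurentDerivation (flow n) (laurentDerivation (flow m) f) := by
      intro f
      ext i
      exact MultiTimeRing.flow_comm m n (f.coeff i)
    ext1 k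
    change laurentDerivation (flow m) (laurentDerivation (flow n) (p.part k) +
          k • (zpow (n : ℤ) * p.part k)) +
        k • (zpow (m : ℤ) * (laurentDerivation (flow n) (p.part k) +
          k • (zpow (n : ℤ) * p.part k))) =
      laurentDerivation (flow n) (laurentDerivation (flow m) (p.part k) +
          k • (zpow (m : ℤ) * p.part k)) +
        k • (zpow (n : ℤ) * (laurentDerivation (flow m) (p.part k) +
          k • (zpow (m : ℤ) * p.part k)))
    simp only [map_add, map_zsmul, Derivation.leibniz, hz, hc, smul_eq_mul, mul_zero, add_zero]
    simp only [zsmul_eq_mul]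
    ring

end WaveRing

/-! ### Shifts of the multi-time -/

section Shift

variable {B : Type*} [CommRing B] [Algebra ℚ B] [MultiTimeRing B]

/-- The operator series `ε ∑_{l ≥ 1} (Xˡ / l) ∂/∂tₗ`. -/
def shiftExponent (B : Type*) [CommRing B] [Algebra ℚ B] [MultiTimeRing B] (ε : ℚ) :
    PowerSeries (Module.End ℚ B) :=
  PowerSeries.mk fun l =>
    if h : 0 < l then (ε / l) • (flow (B := B) ⟨l, h⟩ : B →ₗ[ℚ] B) else 0

/-- The operator `pₙ(ε[∂])`, where `[∂] = (∂/∂t₁, (1/2) ∂/∂t₂, (1/3) ∂/∂t₃, …)` and the Schur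
polynomials are defined by `exp (∑_{l ≥ 1} Xˡ sₗ) = ∑ₙ pₙ(s) Xⁿ`: the coefficient of `Xⁿ` in the
exponential of `shiftExponent`. Since this series has no constant term, only its powers up to
the `n`-th contribute. -/
def schurOp (ε : ℚ) (n : ℕ) : Module.End ℚ B :=
  PowerSeries.coeff n
    (∑ k ∈ Finset.range (n + 1), ((k.factorial : ℚ)⁻¹) • shiftExponent B ε ^ k)

/-- The Taylor expansion of `f(t + ε[z⁻¹])`, with `[z⁻¹] = (z⁻¹, z⁻²/2, z⁻³/3, …)`, in powers
of `z⁻¹`. -/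
def shift (ε : ℚ) (f : B) : WaveRing B :=
  WaveRing.term 0 (HahnSeries.ofPowerSeries ℤ B (PowerSeries.mk fun n => schurOp ε n f))

end Shift

/-! ### Pseudo-differential operators -/

/-- A formal pseudo-differential operator `∑_{k ≤ N} aₖ Dᵏ`; `coeff k` is `aₖ`. -/
@[ext] structure PDO (B : Type*) [Zero B] where
  coeff : ℤ → B
  bounded : ∃ N : ℤ, ∀ k, N < k → coeff k = 0

namespace PDO

section Basic

variable {B : Type*} [CommRing B]

/-- The operator `a Dᵏ`. -/
def mono (a : B) (k : ℤ) : PDO B where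
  coeff l := if l = k then a else 0
  bounded := ⟨k, fun l hl => if_neg (by omega)⟩

/-- The operator of multiplication by a function. -/
def ofFun (a : B) : PDO B := mono a 0

/-- The operator `Dᵏ`. -/
def D (k : ℤ) : PDO B := mono 1 k

/-- The differential part `P₊`. -/
def posPart (P : PDO B) : PDO B where
  coeff k := if 0 ≤ k then P.coeff k else 0
  bounded := by
    obtain ⟨N, hN⟩ := P.bounded
    exact ⟨N, fun k hk => by simp [hN k hk]⟩

/-- The purely pseudo-differential part `P₋`. -/
def negPart (P : PDO B) : PDO B where
  coeff k := if 0 ≤ k then 0 else P.coeff k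
  bounded := ⟨0, fun _ hk => if_pos hk.le⟩

/-- The residue, i.e. the coefficient of `D⁻¹`. -/
def res (P : PDO B) : B := P.coeff (-1)

/-- Apply a ring homomorphism to the coefficients. -/
def map {B' : Type*} [CommRing B'] (φ : B →+* B') (P : PDO B) : PDO B' where
  coeff k := φ (P.coeff k)
  bounded := by
    obtain ⟨N, hN⟩ := P.bounded
    exact ⟨N, fun k hk => by simp [hN k hk]⟩

theorem bddBelow_symbol (P : PDO B) (u : ℤ → B) :
    BddBelow (Function.support fun i : ℤ => u i * P.coeff (-i)) := by
  obtain ⟨N, hN⟩ := P.bounded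
  refine ⟨-N, fun i hi => ?_⟩
  by_contra hlt
  exact hi (by simp [hN (-i) (by omega)])

/-- The action on the exponential: `P(e^{ξ(t,z)}) = ∑ₖ aₖ zᵏ e^{ξ(t,z)}`. -/
def applyExp (P : PDO B) : WaveRing B :=
  WaveRing.term 1 (HahnSeries.ofSuppBddBelow _ (P.bddBelow_symbol fun _ => 1))

/-- The action on the inverse exponential: `P(e^{-ξ(t,z)}) = ∑ₖ aₖ (-z)ᵏ e^{-ξ(t,z)}`. -/
def applyExpNeg (P : PDO B) : WaveRing B :=
  WaveRing.term (-1)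
    (HahnSeries.ofSuppBddBelow _ (P.bddBelow_symbol fun i => ((Int.negOnePow i : ℤ) : B)))

end Basic

variable {B : Type*} [CommRing B] [Algebra ℚ B] [MultiTimeRing B]

/-- The summand of index `(k, j)` in the coefficient of `Dᵐ` of a product: since
`Dᵏ b = ∑_{j ≥ 0} (k choose j) (∂ʲ b) Dᵏ⁻ʲ`, the term `aₖ Dᵏ bₗ Dˡ` contributes
`(k choose j) aₖ ∂ʲ(bₗ)` with `l = m + j - k`. -/
def mulTerm (P Q : PDO B) (m : ℤ) (p : ℤ × ℕ) : B :=
  Ring.choose p.1 p.2 • (P.coeff p.1 * (flow 1)^[p.2] (Q.coeff (m + p.2 - p.1)))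

theorem iterate_flow_zero (j : ℕ) : (flow (B := B) 1)^[j] 0 = 0 :=
  Function.iterate_fixed (map_zero _) j

/-- Only finitely many summands of a coefficient of a product are nonzero. -/
theorem finite_support_mulTerm (P Q : PDO B) (m : ℤ) :
    (Function.support (mulTerm P Q m)).Finite := by
  obtain ⟨N, hN⟩ := P.bounded
  obtain ⟨M, hM⟩ := Q.bounded
  refine ((Set.finite_Icc (m - M) N).prod (Set.finite_Iic (N + M - m).toNat)).subset ?_
  rintro ⟨k, j⟩ hkj
  have h1 : k ≤ N := by
    by_contra h
    exact hkj (by simp [mulTerm, hN k (by omega)])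
  have h2 : m + j - k ≤ M := by
    by_contra h
    exact hkj (by simp [mulTerm, hM (m + j - k) (by omega)])
  simp only [Set.mem_prod, Set.mem_Icc, Set.mem_Iic]
  omega

/-- The product of operators, given by the generalized Leibniz rule. -/
instance : Mul (PDO B) where
  mul P Q :=
    { coeff := fun m => ∑ᶠ p : ℤ × ℕ, mulTerm P Q m p
      bounded := by
        obtain ⟨N, hN⟩ := P.bounded
        obtain ⟨M, hM⟩ := Q.bounded
        refine ⟨N + M, fun m hm => finsum_eq_zero_of_forall_eq_zero ?_⟩
        rintro ⟨k, j⟩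
        by_cases hk : N < k
        · simp [mulTerm, hN k hk]
        · simp [mulTerm, hM (m + j - k) (by omega)] }

/-- The formal adjoint `P* = ∑ₖ (-D)ᵏ aₖ`; its coefficient of `Dᵐ` is
`∑_{j ≥ 0} (-1)ᵐ⁺ʲ (m + j choose j) ∂ʲ(a_{m+j})`. -/
def adjoint (P : PDO B) : PDO B where
  coeff m := ∑ᶠ j : ℕ, ((Int.negOnePow (m + j) : ℤ) * Ring.choose (m + j) j) •
    (flow 1)^[j] (P.coeff (m + j))
  bounded := by
    obtain ⟨N, hN⟩ := P.bounded
    refine ⟨N, fun m hm => finsum_eq_zero_of_forall_eq_zero fun j => ?_⟩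
    rw [hN (m + j) (by omega), iterate_flow_zero, smul_zero]

end PDO

/-! ### The KP hierarchy -/

section Hierarchy

variable {A : Type*} [CommRing A] [Algebra ℚ A] [MultiTimeRing A]

/-- The operator `W Dⁿ W⁻¹`, where `V = W⁻¹`. For the Lax operator `L = W Dʳ W⁻¹` of any order
`r ≥ 1` this is the fractional power `L^{n/r}`. -/
def laxPow (W V : PDO A) (n : ℕ+) : PDO A := W * (PDO.D (n : ℤ) * V)

/-- `W = 1 + ∑_{n ≥ 1} wₙ D⁻ⁿ` is a dressing operator of the KP hierarchy, with inverse `V = W⁻¹`: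
it satisfies the Wilson–Sato equations `∂W/∂tₙ = -(L^{n/r})₋ W` for all `n ≥ 1`. -/
structure IsDressing (W V : PDO A) : Prop where
  coeff_zero : W.coeff 0 = 1
  coeff_pos : ∀ k : ℤ, 0 < k → W.coeff k = 0
  mul_inv : W * V = PDO.ofFun 1
  inv_mul : V * W = PDO.ofFun 1
  wilson_sato : ∀ (n : ℕ+) (k : ℤ),
    flow n (W.coeff k) = -(((laxPow W V n).negPart * W).coeff k)

/-- The Baker–Akhiezer function `ψ(t,z) = W(e^{ξ(t,z)})`. -/
def waveFun (W : PDO A) : WaveRing A := W.applyExp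

/-- The adjoint Baker–Akhiezer function `ψ*(t,z) = (W*)⁻¹(e^{-ξ(t,z)})`, with `(W*)⁻¹ = (W⁻¹)*`
and `V = W⁻¹`. -/
def adjWaveFun (V : PDO A) : WaveRing A := V.adjoint.applyExpNeg

/-- `τ` is a tau-function of the solution with dressing operator `W = V⁻¹`:
`ψ(t,z) = τ(t - [z⁻¹]) / τ(t) · e^{ξ(t,z)}` and `ψ*(t,z) = τ(t + [z⁻¹]) / τ(t) · e^{-ξ(t,z)}`. -/
structure IsTau (W V : PDO A) (τ : Aˣ) : Prop where
  wave : waveFun W = shift (-1) (τ : A) * WaveRing.const (↑τ⁻¹ : A) * WaveRing.expXi 1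
  adjWave : adjWaveFun V = shift 1 (τ : A) * WaveRing.const (↑τ⁻¹ : A) * WaveRing.expXi (-1)

end Hierarchy

/-- `S` is a squared eigenfunction potential of `Φ` and `Ψ` for the hierarchy whose Lax powers are
`P n = L^{n/r}`: `∂S/∂tₙ = Res (D⁻¹ Ψ (L^{n/r})₊ Φ D⁻¹)` for all `n ≥ 1`. -/
def IsSEP {B : Type*} [CommRing B] [Algebra ℚ B] [MultiTimeRing B] (P : ℕ+ → PDO B)
    (Φ Ψ S : B) : Prop :=
  ∀ n : ℕ+, flow n S =
    (PDO.D (-1) * (PDO.ofFun Ψ * ((P n).posPart * (PDO.ofFun Φ * PDO.D (-1))))).res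

/-! ### Three spectral parameters

The parameters `μ`, `λ`, `z` are adjoined in this order, so that all expansions are those of the
region `|μ| < |λ| < |z|`. -/

section Spectral

variable {A : Type*} [CommRing A] [Algebra ℚ A] [MultiTimeRing A]

/-- Series in `μ⁻¹`, `λ⁻¹` over `A`, with exponentials. -/
abbrev Ring2 (A : Type*) [CommRing A] : Type _ := WaveRing (WaveRing A)

/-- Series in `μ⁻¹`, `λ⁻¹`, `z⁻¹` over `A`, with exponentials. -/
abbrev Ring3 (A : Type*) [CommRing A] : Type _ := WaveRing (Ring2 A)

/-- Functions of `t` inside `Ring2 A`. -/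
def toRing2 : A →+* Ring2 A := WaveRing.const.comp WaveRing.const

/-- Functions of `t` inside `Ring3 A`. -/
def toRing3 : A →+* Ring3 A := WaveRing.const.comp toRing2

/-- The bilocal vertex operator
`X(λ,μ) = λ⁻¹ e^{ξ(t+[λ⁻¹],μ) - ξ(t,λ)} exp(∑_{l ≥ 1} (λ⁻ˡ - μ⁻ˡ)/l ∂/∂tₗ)`
applied to a function `f(t)`. -/
def vertexOp (f : A) : Ring2 A :=
  WaveRing.spec (-1) * (shift 1 (WaveRing.expXi 1 : WaveRing A) * WaveRing.expXi (-1)) *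
    shift 1 (shift (-1) f)

/-- `ψ(t,μ)` in `Ring2 A`. -/
def psiMu (W : PDO A) : Ring2 A := WaveRing.const (waveFun W)

/-- `ψ*(t,λ)` in `Ring2 A`. -/
def psiStarLambda (V : PDO A) : Ring2 A := adjWaveFun (V.map WaveRing.const)

/-- `ψ(t,z)` in `Ring3 A`. -/
def psiZ (W : PDO A) : Ring3 A := waveFun (W.map toRing2)

/-- The action of the vertex operator on `ψ(t,z) = e^{ξ(t,z)} τ(t - [z⁻¹]) / τ(t)`, induced by the
variation `τ ↦ X(λ,μ)τ` of the tau-function: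
`e^{ξ(t,z)} (τ(t) (Xτ)(t - [z⁻¹]) - τ(t - [z⁻¹]) (Xτ)(t)) / τ(t)²`. -/
def vertexActionOnWave (τ : Aˣ) : Ring3 A :=
  WaveRing.expXi 1 *
    (toRing3 (τ : A) * shift (-1) (vertexOp (τ : A)) -
      shift (-1) (toRing2 (τ : A)) * WaveRing.const (vertexOp (τ : A))) *
    toRing3 (↑τ⁻¹ : A) ^ 2

/-- `S` is the squared eigenfunction potential `S(ψ(t,z), ψ*(t,λ))`. The defining equations fix it
up to a constant; the constant is fixed by asking that `S` be `e^{ξ(t,z)}` times a formal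
Laurent series in `z⁻¹`, like `ψ(t,z)` itself. -/
def IsWaveSEP (W V : PDO A) (S : Ring3 A) : Prop :=
  IsSEP (fun n => (laxPow W V n).map toRing3) (psiZ W) (WaveRing.const (psiStarLambda V)) S ∧
    ∃ s : LaurentSeries (Ring2 A), S = WaveRing.term 1 s

/-- The pseudo-differential operator `Y(λ,μ) = ψ(t,μ) D⁻¹ ψ*(t,λ)`. -/
def ghostOp (W V : PDO A) : PDO (Ring2 A) :=
  PDO.ofFun (psiMu W) * (PDO.D (-1) * PDO.ofFun (psiStarLambda V))

/-- The ghost flow `∂W = Y(λ,μ) W`, transferred to the Baker–Akhiezer function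
`ψ(t,z) = W(e^{ξ(t,z)})`: the function `(Y(λ,μ) W)(e^{ξ(t,z)})`. -/
def ghostFlowOnWave (W V : PDO A) : Ring3 A :=
  (ghostOp W V * W.map toRing2).applyExp

end Spectral

end KP

end

noncomputable section

namespace KP

open Finset

/-! ### Reindexing of iterated sums over antidiagonals -/

section Antidiagonal

/-! Both the vertex operator and the squared eigenfunction potential can be written through shifted
tau-functions, and the identity between them is then Fay's trisecant identity for `τ`. That identity
is itself extracted from the Wilson–Sato equations.

Fay's identity. The expansion `F(Y) = f(t + ε[Y])` is the unique solution of `Y dF/dY = ε ∑ Yˡ ∂ₗF`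
with `F(0) = f`; this replaces every manipulation of the exponential series. The functions `(P
W)(e^ξ)` with `P` differential are stable under all flows, so by this recurrence every coefficient
of `ψ(t - [Y], z)` in powers of `Y` has that form. For the powers `Yⁿ` with `n ≥ 2` the orders force
`P` to be a function. The outcome is the linear problem `ψ(t - [Y]) = ψ - Y (∂ + w₁(t - [Y]) -
w₁(t)) ψ` (`IsDressing.psShift_symbolSeries`). Inserting `ψ = τ(t - [z⁻¹])/τ · e^ξ` gives the
differential Fay identity (`differential_fay`). Moving the base point by `+[X]` or `+[Y]` gives two
variants, and eliminating the derivatives of `log τ` from three instances gives `fay`.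

The potential. The candidate is `S = (D⁻¹ ψ* W)(e^ξ)` (`sep`), for which the ghost-flow formula is
just associativity of operators. It satisfies all the flow equations because the adjoint linear
problem for `ψ*` cancels the residue obstructing `∇ₙ(D⁻¹ ψ* W)` from being a differential operator
times `W` (`isSEP_sep`). Uniqueness holds because `∂ₓ` acts on `s(z) e^ξ` as `∂ₓ + z` on `s`, which
kills no nonzero Laurent series in `z⁻¹` (`WaveRing.eq_zero_of_flow_term`). The same uniqueness
together with the differential Fay identity evaluates the potential (`waveSEP_eq`): `(λ⁻¹ - z⁻¹) S =
λ⁻¹ z⁻¹ e^{ξ(t,z) - ξ(t,λ)} τ(t + [λ⁻¹] - [z⁻¹]) / τ`.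

The vertex operator. Likewise `(μ⁻¹ - λ⁻¹) Xτ = μ⁻¹ λ⁻¹ e^{ξ(t,μ) - ξ(t,λ)} τ(t + [λ⁻¹] - [μ⁻¹])`
(`vertexOp_eq`). After multiplication by the units `μ⁻¹ - λ⁻¹` and `λ⁻¹ - z⁻¹`, the claim is `fay`
at `X₁ = μ⁻¹`, `X₂ = λ⁻¹`, `X₃ = z⁻¹`. -/

theorem sum_antidiagonal_rotate {M : Type*} [AddCommMonoid M] (n : ℕ) (f : ℕ → ℕ → ℕ → M) :
    ∑ p ∈ antidiagonal n, ∑ q ∈ antidiagonal p.2, f p.1 q.1 q.2 =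
      ∑ p ∈ antidiagonal n, ∑ q ∈ antidiagonal p.2, f q.1 p.1 q.2 := by
  rw [sum_sigma', sum_sigma']
  refine sum_nbij' (fun x => ⟨(x.2.1, x.1.1 + x.2.2), (x.1.1, x.2.2)⟩)
    (fun x => ⟨(x.2.1, x.1.1 + x.2.2), (x.1.1, x.2.2)⟩) ?_ ?_ ?_ ?_ ?_ <;>
  · rintro ⟨⟨a, b⟩, ⟨c, d⟩⟩ h
    simp only [mem_sigma, HasAntidiagonal.mem_antidiagonal] at h
    obtain ⟨h1, rfl⟩ := h
    first | rfl | (simp only [mem_sigma, HasAntidiagonal.mem_antidiagonal, and_true]; omega)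

theorem sum_antidiagonal_assoc {M : Type*} [AddCommMonoid M] (n : ℕ) (f : ℕ → ℕ → ℕ → M) :
    ∑ p ∈ antidiagonal n, ∑ q ∈ antidiagonal p.1, f q.1 q.2 p.2 =
      ∑ p ∈ antidiagonal n, ∑ q ∈ antidiagonal p.2, f p.1 q.1 q.2 := by
  rw [sum_sigma', sum_sigma']
  refine sum_nbij' (fun x => ⟨(x.2.1, x.2.2 + x.1.2), (x.2.2, x.1.2)⟩)
    (fun x => ⟨(x.1.1 + x.2.1, x.2.2), (x.1.1, x.2.1)⟩) ?_ ?_ ?_ ?_ ?_ <;>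
  · rintro ⟨⟨a, b⟩, ⟨c, d⟩⟩ h
    simp only [mem_sigma, HasAntidiagonal.mem_antidiagonal] at h
    obtain ⟨h1, rfl⟩ := h
    first | rfl | (simp only [mem_sigma, HasAntidiagonal.mem_antidiagonal, and_true]; omega)

theorem sum_antidiagonal_interchange {M : Type*} [AddCommMonoid M] (n : ℕ)
    (f : ℕ → ℕ → ℕ → ℕ → M) :
    ∑ p ∈ antidiagonal n, ∑ q ∈ antidiagonal p.1, ∑ r ∈ antidiagonal p.2, f q.1 q.2 r.1 r.2 =
      ∑ p ∈ antidiagonal n, ∑ q ∈ antidiagonal p.1, ∑ r ∈ antidiagonal p.2,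
        f q.1 r.1 q.2 r.2 := by
  have h1 := fun g : ℕ → ℕ → ℕ → ℕ → M =>
    sum_antidiagonal_assoc n (fun a b m => ∑ r ∈ antidiagonal m, g a b r.1 r.2)
  rw [h1 f, h1 fun a b c d => f a c b d]
  refine sum_congr rfl fun p _ => ?_
  exact sum_antidiagonal_rotate p.2 fun b c d => f p.1 b c d

end Antidiagonal

/-! ### The Euler operator and exponentials over a noncommutative coefficient ring -/

section EulerNoncomm

variable {R : Type*} [Ring R]

/-- The Euler operator `X d/dX`. -/
def psEuler (f : PowerSeries R) : PowerSeries R := PowerSeries.mk fun n => n • PowerSeries.coeff n f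

theorem psEuler_mul (f g : PowerSeries R) : psEuler (f * g) = psEuler f * g + f * psEuler g := by
  ext n
  simp only [psEuler, PowerSeries.coeff_mk, PowerSeries.coeff_mul, map_add, smul_sum,
    ← sum_add_distrib]
  refine sum_congr rfl fun p hp => ?_
  rw [HasAntidiagonal.mem_antidiagonal] at hp
  rw [← hp, add_smul, smul_mul_assoc, mul_smul_comm]

theorem psEuler_pow {E : PowerSeries R} (h : Commute E (psEuler E)) (k : ℕ) :
    psEuler (E ^ (k + 1)) = (k + 1) • (psEuler E * E ^ k) := by
  induction k with
  | zero => simp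
  | succ k ih =>
    rw [pow_succ, psEuler_mul, ih, add_smul (k + 1), one_smul, smul_mul_assoc, mul_assoc,
      ← pow_succ, (h.pow_left (k + 1)).eq]

theorem commute_psEuler {E : PowerSeries R}
    (h : ∀ i j, Commute (PowerSeries.coeff i E) (PowerSeries.coeff j E)) :
    Commute E (psEuler E) := by
  ext n
  rw [PowerSeries.coeff_mul, PowerSeries.coeff_mul, ← Nat.sum_antidiagonal_swap]
  refine sum_congr rfl fun p _ => ?_
  simp only [psEuler, PowerSeries.coeff_mk, Prod.fst_swap, Prod.snd_swap]
  exact ((h _ _).smul_right _).eq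

theorem coeff_pow_of_lt {E : PowerSeries R} (h0 : PowerSeries.coeff 0 E = 0) {n k : ℕ}
    (h : n < k) : PowerSeries.coeff n (E ^ k) = 0 := by
  induction k generalizing n with
  | zero => omega
  | succ k ih =>
    rw [pow_succ', PowerSeries.coeff_mul]
    refine sum_eq_zero fun p hp => ?_
    rw [HasAntidiagonal.mem_antidiagonal] at hp
    rcases Nat.eq_zero_or_pos p.1 with h1 | h1
    · rw [h1, h0, zero_mul]
    · rw [ih (by omega), mul_zero]

variable [Algebra ℚ R]

/-- The truncated exponential series. -/
def expTrunc (E : PowerSeries R) (K : ℕ) : PowerSeries R :=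
  ∑ k ∈ range K, ((k.factorial : ℚ)⁻¹) • E ^ k

theorem coeff_expTrunc {E : PowerSeries R} (h0 : PowerSeries.coeff 0 E = 0) {n K : ℕ}
    (h : n < K) :
    PowerSeries.coeff n (expTrunc E K) = PowerSeries.coeff n (expTrunc E (n + 1)) := by
  induction K, h using Nat.le_induction with
  | base => rfl
  | succ K hK ih =>
    rw [expTrunc, sum_range_succ, map_add, ← expTrunc, ih, PowerSeries.coeff_smul,
      coeff_pow_of_lt h0 hK, smul_zero, add_zero]

/-- The formal `d(exp E) = dE · exp E`, valid in a noncommutative ring because `E` commutes with its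
Euler derivative. Differentiation loses one term of the truncation. -/
theorem psEuler_expTrunc {E : PowerSeries R} (h : Commute E (psEuler E)) (K : ℕ) :
    psEuler (expTrunc E (K + 1)) = psEuler E * expTrunc E K := by
  have hadd : ∀ f g : PowerSeries R, psEuler (f + g) = psEuler f + psEuler g := fun f g => by
    ext n; simp [psEuler]
  have hsmul : ∀ (c : ℚ) (f : PowerSeries R), psEuler (c • f) = c • psEuler f := fun c f => by
    ext n; simp [psEuler]
  induction K with
  | zero =>
    ext n
    rcases Nat.eq_zero_or_pos n with rfl | h
    · simp [expTrunc, psEuler]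
    · simp [expTrunc, psEuler, PowerSeries.coeff_one, h.ne']
  | succ K ih =>
    rw [expTrunc, sum_range_succ, ← expTrunc, hadd, ih, expTrunc, expTrunc, sum_range_succ, mul_add,
      hsmul, psEuler_pow h, mul_smul_comm]
    congr 1
    rw [← Nat.cast_smul_eq_nsmul ℚ, smul_smul, Nat.factorial_succ]
    congr 1
    have := Nat.factorial_ne_zero K
    push_cast
    field_simp

end EulerNoncomm

/-! ### Setting two formal variables equal -/

section Diagonal

variable {B : Type*} [CommRing B]

/-- The restriction of a double power series `F(X, Y)` to `X = Y`. -/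
def psDiag : PowerSeries (PowerSeries B) →+* PowerSeries B where
  toFun F := PowerSeries.mk fun n =>
    ∑ p ∈ antidiagonal n, PowerSeries.coeff p.2 (PowerSeries.coeff p.1 F)
  map_zero' := by ext n; simp
  map_one' := by
    ext n
    rw [PowerSeries.coeff_mk, sum_eq_single (0, n)]
    · simp
    · rintro ⟨a, b⟩ h h'
      rw [HasAntidiagonal.mem_antidiagonal] at h
      have : a ≠ 0 := by
        rintro rfl
        exact h' (by simpa using h)
      simp [PowerSeries.coeff_one, this]
    · simp
  map_add' F G := by ext n; simp [sum_add_distrib]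
  map_mul' F G := by
    ext n
    simp only [PowerSeries.coeff_mk, PowerSeries.coeff_mul, map_sum, sum_mul_sum]
    exact sum_antidiagonal_interchange n fun a b c d =>
      PowerSeries.coeff c (PowerSeries.coeff a F) * PowerSeries.coeff d (PowerSeries.coeff b G)

theorem coeff_psDiag (F : PowerSeries (PowerSeries B)) (n : ℕ) :
    PowerSeries.coeff n (psDiag F) =
      ∑ p ∈ antidiagonal n, PowerSeries.coeff p.2 (PowerSeries.coeff p.1 F) := by
  simp [psDiag]

theorem psDiag_map_C (F : PowerSeries B) : psDiag (PowerSeries.map PowerSeries.C F) = F := by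
  ext n
  rw [coeff_psDiag, sum_eq_single (n, 0)]
  · simp
  · rintro ⟨a, b⟩ h h'
    rw [HasAntidiagonal.mem_antidiagonal] at h
    have : b ≠ 0 := by
      rintro rfl
      exact h' (by simpa using h)
    simp [PowerSeries.coeff_C, this]
  · simp

theorem psDiag_C (F : PowerSeries B) : psDiag (PowerSeries.C F) = F := by
  ext n
  rw [coeff_psDiag, sum_eq_single (0, n)]
  · simp
  · rintro ⟨a, b⟩ h h'
    rw [HasAntidiagonal.mem_antidiagonal] at h
    have : a ≠ 0 := by
      rintro rfl
      exact h' (by simpa using h)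
    simp [PowerSeries.coeff_C, this]
  · simp

end Diagonal

/-! ### Formal Taylor shifts of the multi-time, characterised by an Euler equation -/

section ShiftSeries

variable {B : Type*} [CommRing B] [Algebra ℚ B]

section SeqDerivation

/-- The derivation `∑ₗ Xˡ dₗ` of power series, for a sequence of derivations `dₗ` of the
coefficient ring. -/
def seqDerivation (d : ℕ → Derivation ℚ B B) : Derivation ℚ (PowerSeries B) (PowerSeries B) :=
  Derivation.mk'
    { toFun := fun F => PowerSeries.mk fun n =>
        ∑ p ∈ antidiagonal n, d p.1 (PowerSeries.coeff p.2 F)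
      map_add' := fun F G => by ext n; simp [sum_add_distrib]
      map_smul' := fun c F => by ext n; simp [smul_sum] } <| by
    intro F G
    ext n
    simp only [LinearMap.coe_mk, AddHom.coe_mk, PowerSeries.coeff_mk, PowerSeries.coeff_mul,
      map_sum, Derivation.leibniz, smul_eq_mul, map_add, mul_sum, sum_add_distrib]
    congr 1
    · exact sum_antidiagonal_rotate n fun i a b =>
        PowerSeries.coeff a F * d i (PowerSeries.coeff b G)
    · have := sum_antidiagonal_rotate n fun i b a =>
        PowerSeries.coeff b G * d i (PowerSeries.coeff a F)
      rw [← this]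
      refine sum_congr rfl fun p _ => ?_
      rw [← Nat.sum_antidiagonal_swap]
      rfl

theorem coeff_seqDerivation (d : ℕ → Derivation ℚ B B) (F : PowerSeries B) (n : ℕ) :
    PowerSeries.coeff n (seqDerivation d F) =
      ∑ p ∈ antidiagonal n, d p.1 (PowerSeries.coeff p.2 F) := by
  simp [seqDerivation]

/-- A derivation of the coefficient ring, acting on power series coefficientwise. -/
def psDerivation (d : Derivation ℚ B B) : Derivation ℚ (PowerSeries B) (PowerSeries B) :=
  seqDerivation fun l => if l = 0 then d else 0

@[simp] theorem coeff_psDerivation (d : Derivation ℚ B B) (F : PowerSeries B) (n : ℕ) :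
    PowerSeries.coeff n (psDerivation d F) = d (PowerSeries.coeff n F) := by
  rw [psDerivation, coeff_seqDerivation, sum_eq_single (0, n)]
  · simp
  · rintro ⟨a, b⟩ h h'
    rw [HasAntidiagonal.mem_antidiagonal] at h
    have : a ≠ 0 := by
      rintro rfl
      exact h' (by simpa using h)
    simp [this]
  · simp

end SeqDerivation

variable [MultiTimeRing B]

instance : MultiTimeRing (PowerSeries B) where
  flow n := psDerivation (flow n)
  flow_comm m n F := by
    ext i
    simp only [coeff_psDerivation]
    exact MultiTimeRing.flow_comm m n _

@[simp] theorem coeff_flow (n : ℕ+) (F : PowerSeries B) (i : ℕ) :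
    PowerSeries.coeff i (flow n F) = flow n (PowerSeries.coeff i F) :=
  coeff_psDerivation _ _ _

theorem flow_C (n : ℕ+) (b : B) : flow n (PowerSeries.C b) = PowerSeries.C (flow n b) := by
  ext i
  rw [coeff_flow, PowerSeries.coeff_C, PowerSeries.coeff_C]
  split_ifs <;> simp

theorem flow_X (n : ℕ+) : flow n (PowerSeries.X : PowerSeries B) = 0 := by
  ext i
  rw [coeff_flow, PowerSeries.coeff_X]
  split_ifs <;> simp

/-- `∂/∂tₗ`, set to `0` for `l = 0`. -/
def flowNat (l : ℕ) : Derivation ℚ B B := if h : 0 < l then flow (l.toPNat h) else 0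

theorem flowNat_comm (m n : ℕ) (f : B) : flowNat m (flowNat n f) = flowNat n (flowNat m f) := by
  unfold flowNat
  split_ifs
  · exact MultiTimeRing.flow_comm _ _ _
  all_goals simp

theorem flow_flowNat_comm (m : ℕ+) (n : ℕ) (f : B) :
    flow m (flowNat n f) = flowNat n (flow m f) := by
  unfold flowNat
  split_ifs
  · exact MultiTimeRing.flow_comm _ _ _
  · simp

theorem coeff_shiftExponent (ε : ℚ) (l : ℕ) (f : B) :
    PowerSeries.coeff l (shiftExponent B ε) f = (ε / l) • flowNat l f := by
  rw [shiftExponent, PowerSeries.coeff_mk, flowNat]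
  split_ifs
  · rfl
  · simp

/-- Apply the Euler operator to the exponential defining `schurOp`: the weight `l` cancels the
denominators in `ε Xˡ ∂ₗ / l`. -/
theorem schurOp_recurrence (ε : ℚ) (n : ℕ) (f : B) :
    (n : ℚ) • schurOp ε n f = ε • ∑ p ∈ antidiagonal n, flowNat p.1 (schurOp ε p.2 f) := by
  set E := shiftExponent B ε with hE
  have h0 : PowerSeries.coeff 0 E = 0 := by
    ext f; rw [hE, coeff_shiftExponent]; simp
  have hc : Commute E (psEuler E) := by
    refine commute_psEuler fun i j => ?_
    ext f
    simp only [Module.End.mul_apply, hE, coeff_shiftExponent, Derivation.map_smul,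
      flowNat_comm i j]
    exact smul_comm _ _ _
  have hs : ∀ m, schurOp ε m = PowerSeries.coeff m (expTrunc E (m + 1)) := fun m => rfl
  have h := congrArg (PowerSeries.coeff n) (psEuler_expTrunc hc n)
  rw [psEuler, PowerSeries.coeff_mk, ← hs, PowerSeries.coeff_mul] at h
  have h' := congrArg (fun T : Module.End ℚ B => T f) h
  simp only [LinearMap.smul_apply, LinearMap.sum_apply, Module.End.mul_apply] at h'
  rw [Nat.cast_smul_eq_nsmul, h', smul_sum]
  refine sum_congr rfl fun p hp => ?_
  rw [HasAntidiagonal.mem_antidiagonal] at hp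
  rcases Nat.eq_zero_or_pos p.1 with h1 | h1
  · simp [h1, psEuler, flowNat]
  · rw [coeff_expTrunc h0 (by omega), ← hs, psEuler, PowerSeries.coeff_mk, LinearMap.smul_apply, hE,
      coeff_shiftExponent, ← Nat.cast_smul_eq_nsmul ℚ, smul_smul]
    congr 1
    have : (p.1 : ℚ) ≠ 0 := by exact_mod_cast h1.ne'
    field_simp

theorem schurOp_zero (ε : ℚ) (f : B) : schurOp ε 0 f = f := by
  simp [schurOp]

/-- Power series `F(X)` with `X dF/dX = ε ∑_{l ≥ 1} Xˡ ∂F/∂tₗ`. -/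
def IsShiftSeries (ε : ℚ) (F : PowerSeries B) : Prop :=
  ∀ n : ℕ, (n : ℚ) • PowerSeries.coeff n F = ε • PowerSeries.coeff n (seqDerivation flowNat F)

/-- Since `flowNat 0 = 0`, the equation expresses `n` times the `n`-th coefficient through earlier
ones, and `n` is invertible over `ℚ`. This is the tool for all later identities between shifts. -/
theorem IsShiftSeries.ext {ε : ℚ} {F G : PowerSeries B} (hF : IsShiftSeries ε F)
    (hG : IsShiftSeries ε G) (h : PowerSeries.coeff 0 F = PowerSeries.coeff 0 G) : F = G := by
  ext n
  induction n using Nat.strong_induction_on with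
  | _ n ih =>
    rcases Nat.eq_zero_or_pos n with h1 | h1
    · rw [h1, h]
    · have hn : (n : ℚ) ≠ 0 := by exact_mod_cast h1.ne'
      refine smul_right_injective B hn ?_
      change (n : ℚ) • _ = (n : ℚ) • _
      rw [hF, hG, coeff_seqDerivation, coeff_seqDerivation]
      congr 1
      refine sum_congr rfl fun p hp => ?_
      rw [HasAntidiagonal.mem_antidiagonal] at hp
      rcases Nat.eq_zero_or_pos p.1 with h2 | h2
      · simp [h2, flowNat]
      · rw [ih _ (by omega)]

/-- Both sides of the defining equation are derivations, so its solutions are closed under products;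
this is why the shift is multiplicative. -/
theorem IsShiftSeries.mul {ε : ℚ} {F G : PowerSeries B} (hF : IsShiftSeries ε F)
    (hG : IsShiftSeries ε G) : IsShiftSeries ε (F * G) := by
  intro n
  rw [Derivation.leibniz, PowerSeries.coeff_mul, map_add, smul_eq_mul, smul_eq_mul, mul_comm G,
    PowerSeries.coeff_mul, PowerSeries.coeff_mul, smul_sum, ← sum_add_distrib, smul_sum]
  refine sum_congr rfl fun p hp => ?_
  rw [HasAntidiagonal.mem_antidiagonal] at hp
  have hF' := hF p.1
  have hG' := hG p.2
  rw [smul_add, ← mul_smul_comm ε, ← smul_mul_assoc ε, ← hG', ← hF', smul_mul_assoc, mul_smul_comm,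
    ← add_smul, ← hp, add_comm]
  push_cast
  rfl

theorem isShiftSeries_C {ε : ℚ} {b : B} (h : ∀ n, flow n b = 0) :
    IsShiftSeries ε (PowerSeries.C b) := by
  intro n
  rw [coeff_seqDerivation, sum_eq_zero, smul_zero, PowerSeries.coeff_C]
  · split_ifs with h <;> simp [h]
  · rintro p _
    unfold flowNat
    split_ifs with h1
    · rw [PowerSeries.coeff_C]
      split_ifs
      · exact h _
      · exact map_zero _
    · simp

theorem isShiftSeries_mk (ε : ℚ) (f : B) :
    IsShiftSeries ε (PowerSeries.mk fun n => schurOp ε n f) := by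
  intro n
  simp only [coeff_seqDerivation, PowerSeries.coeff_mk]
  exact schurOp_recurrence ε n f

/-- The Taylor expansion of `f(t + ε[z⁻¹])` as a power series in `X = z⁻¹`. -/
def psShift (ε : ℚ) : B →+* PowerSeries B where
  toFun f := PowerSeries.mk fun n => schurOp ε n f
  map_zero' := by ext n; simp
  map_one' := by
    refine (isShiftSeries_mk ε 1).ext (isShiftSeries_C fun n => ?_) ?_
    · exact Derivation.map_one_eq_zero _
    · simp [schurOp_zero]
  map_add' f g := by ext n; simp
  map_mul' f g := by
    refine (isShiftSeries_mk ε _).ext ((isShiftSeries_mk ε _).mul (isShiftSeries_mk ε _)) ?_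
    simp [schurOp_zero]

theorem coeff_psShift (ε : ℚ) (n : ℕ) (f : B) :
    PowerSeries.coeff n (psShift ε f) = schurOp ε n f := by
  simp [psShift]

theorem isShiftSeries_psShift (ε : ℚ) (f : B) : IsShiftSeries ε (psShift ε f) :=
  isShiftSeries_mk ε f

theorem coeff_zero_psShift (ε : ℚ) (f : B) : PowerSeries.coeff 0 (psShift ε f) = f := by
  rw [coeff_psShift, schurOp_zero]

theorem IsShiftSeries.eq_psShift {ε : ℚ} {F : PowerSeries B} (hF : IsShiftSeries ε F) {f : B}
    (h : PowerSeries.coeff 0 F = f) : psShift ε f = F :=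
  (isShiftSeries_psShift ε f).ext hF (by rw [coeff_zero_psShift, h])

theorem psShift_of_flow_eq_zero (ε : ℚ) {b : B} (h : ∀ n, flow n b = 0) :
    psShift ε b = PowerSeries.C b :=
  (isShiftSeries_C h).eq_psShift (by simp)

/-- Ring homomorphisms commuting with the flows. -/
def IsFlowHom {B' : Type*} [CommRing B'] [Algebra ℚ B'] [MultiTimeRing B'] (φ : B →+* B') : Prop :=
  ∀ (n : ℕ+) (b : B), φ (flow n b) = flow n (φ b)

section Hom

variable {B' : Type*} [CommRing B'] [Algebra ℚ B'] [MultiTimeRing B'] {φ : B →+* B'}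

theorem IsFlowHom.flowNat (h : IsFlowHom φ) (n : ℕ) (b : B) :
    φ (flowNat n b) = KP.flowNat n (φ b) := by
  unfold KP.flowNat
  split_ifs
  · exact h _ _
  · simp

theorem IsFlowHom.map_psShift (h : IsFlowHom φ) (ε : ℚ) (b : B) :
    PowerSeries.map φ (psShift ε b) = psShift ε (φ b) := by
  refine (IsShiftSeries.eq_psShift (fun n => ?_) ?_).symm
  · rw [coeff_seqDerivation, PowerSeries.coeff_map, ← map_rat_smul φ, isShiftSeries_psShift,
      map_rat_smul φ, coeff_seqDerivation, map_sum]
    simp only [h.flowNat, PowerSeries.coeff_map]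
  · rw [PowerSeries.coeff_map, coeff_zero_psShift]

theorem IsFlowHom.comp {B'' : Type*} [CommRing B''] [Algebra ℚ B''] [MultiTimeRing B'']
    {χ : B' →+* B''} (hχ : IsFlowHom χ) (h : IsFlowHom φ) : IsFlowHom (χ.comp φ) := by
  intro n b
  simp only [RingHom.comp_apply, h n b, hχ n]

theorem IsFlowHom.psMap (h : IsFlowHom φ) : IsFlowHom (PowerSeries.map φ) := by
  intro n F
  ext i
  simp only [PowerSeries.coeff_map, coeff_flow, h n]

end Hom

theorem isFlowHom_C : IsFlowHom (PowerSeries.C (R := B)) := fun n b => (flow_C n b).symm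

theorem isFlowHom_psShift (ε : ℚ) : IsFlowHom (psShift (B := B) ε) := by
  intro n b
  refine IsShiftSeries.eq_psShift (fun m => ?_) ?_
  · have := congrArg (flow n) (isShiftSeries_psShift ε b m)
    rw [Derivation.map_smul, Derivation.map_smul, coeff_seqDerivation, map_sum] at this
    rw [coeff_flow, this, coeff_seqDerivation]
    simp only [flow_flowNat_comm, coeff_flow]
  · rw [coeff_flow, coeff_zero_psShift]

theorem schurOp_flowNat (ε : ℚ) (m n : ℕ) (b : B) :
    schurOp ε m (flowNat n b) = flowNat n (schurOp ε m b) := by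
  rcases Nat.eq_zero_or_pos n with rfl | h
  · simp [flowNat]
  · have := congrArg (PowerSeries.coeff m) (isFlowHom_psShift ε (n.toPNat h) b)
    rw [coeff_psShift, coeff_flow, coeff_psShift] at this
    unfold flowNat
    rw [dif_pos h]
    exact this

/-- The substitution `t ↦ t + ε[X]` in a power series `F(t, X)`. -/
def selfShift (ε : ℚ) : PowerSeries B →+* PowerSeries B := psDiag.comp (psShift ε)

theorem selfShift_C (ε : ℚ) (b : B) : selfShift ε (PowerSeries.C b) = psShift ε b := by
  rw [selfShift, RingHom.comp_apply, ← isFlowHom_C.map_psShift, psDiag_map_C]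

theorem selfShift_X (ε : ℚ) : selfShift ε (PowerSeries.X : PowerSeries B) = PowerSeries.X := by
  rw [selfShift, RingHom.comp_apply, psShift_of_flow_eq_zero ε fun n => flow_X n, psDiag_C]

theorem isFlowHom_psDiag : IsFlowHom (psDiag (B := B)) := by
  intro n F
  ext i
  rw [coeff_flow, coeff_psDiag, coeff_psDiag, map_sum]
  simp only [coeff_flow]

theorem isFlowHom_selfShift (ε : ℚ) : IsFlowHom (selfShift (B := B) ε) :=
  isFlowHom_psDiag.comp (isFlowHom_psShift ε)

/-- The shift leaves the formal variable already present untouched, because the flows act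
coefficientwise on it. -/
theorem coeff_psShift_powerSeries (ε : ℚ) (n m : ℕ) (F : PowerSeries B) :
    PowerSeries.coeff m (PowerSeries.coeff n (psShift ε F)) =
      schurOp ε n (PowerSeries.coeff m F) := by
  have hs : IsShiftSeries ε (PowerSeries.mk fun n =>
      PowerSeries.coeff m (PowerSeries.coeff n (psShift ε F))) := by
    intro k
    have := congrArg (PowerSeries.coeff m) (isShiftSeries_psShift ε F k)
    rw [PowerSeries.coeff_smul, PowerSeries.coeff_smul, coeff_seqDerivation, map_sum] at this
    rw [PowerSeries.coeff_mk, this, coeff_seqDerivation]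
    congr 1
    refine sum_congr rfl fun p _ => ?_
    rw [PowerSeries.coeff_mk]
    unfold flowNat
    split_ifs
    · exact coeff_flow _ _ _
    · simp
  have := congrArg (PowerSeries.coeff n) (hs.eq_psShift (f := PowerSeries.coeff m F)
    (by rw [PowerSeries.coeff_mk, coeff_zero_psShift]))
  rw [coeff_psShift, PowerSeries.coeff_mk] at this
  exact this.symm

/-- Shifts by `ε[X]` and `-ε[X]` cancel. By the Euler equation the two shifts contribute opposite
amounts to `n` times the `n`-th coefficient, so only the constant term survives. -/
theorem selfShift_psShift_neg (ε : ℚ) (b : B) :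
    selfShift ε (psShift (-ε) b) = PowerSeries.C b := by
  have hc : ∀ n, PowerSeries.coeff n (selfShift ε (psShift (-ε) b)) =
      ∑ p ∈ antidiagonal n, schurOp ε p.1 (schurOp (-ε) p.2 b) := by
    intro n
    rw [selfShift, RingHom.comp_apply, coeff_psDiag]
    refine sum_congr rfl fun p _ => ?_
    rw [coeff_psShift_powerSeries, coeff_psShift]
  ext n
  rw [hc, PowerSeries.coeff_C]
  split_ifs with h
  · subst h; simp [schurOp_zero]
  · have hn : (n : ℚ) ≠ 0 := by exact_mod_cast h
    refine smul_right_injective B hn ?_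
    change (n : ℚ) • _ = (n : ℚ) • (0 : B)
    -- The factor `n` is split as `p.1 + p.2`, so that each Schur operator can use its own
    -- recurrence.
    have h1 : (n : ℚ) • ∑ p ∈ antidiagonal n, schurOp ε p.1 (schurOp (-ε) p.2 b) =
        ∑ p ∈ antidiagonal n, ((p.1 : ℚ) • schurOp ε p.1 (schurOp (-ε) p.2 b) +
          schurOp ε p.1 ((p.2 : ℚ) • schurOp (-ε) p.2 b)) := by
      rw [smul_sum]
      refine sum_congr rfl fun p hp => ?_
      rw [HasAntidiagonal.mem_antidiagonal] at hp
      rw [map_smul, ← add_smul, ← hp]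
      push_cast
      rfl
    rw [h1, smul_zero, sum_add_distrib]
    have h2 : ∀ p : ℕ × ℕ, schurOp ε p.1 ((p.2 : ℚ) • schurOp (-ε) p.2 b) =
        (-ε) • ∑ q ∈ antidiagonal p.2, flowNat q.1 (schurOp ε p.1 (schurOp (-ε) q.2 b)) := by
      intro p
      rw [schurOp_recurrence, map_smul, map_sum]
      simp only [schurOp_flowNat]
    simp only [h2]
    simp only [schurOp_recurrence, ← smul_sum]
    rw [sum_antidiagonal_assoc n fun i j k => flowNat i (schurOp ε j (schurOp (-ε) k b)),
      sum_antidiagonal_rotate n fun i j k => flowNat i (schurOp ε j (schurOp (-ε) k b))]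
    rw [neg_smul, add_neg_cancel]

end ShiftSeries

end KP

end

noncomputable section

namespace KP

open Finset

/-! ### The ring of formal pseudo-differential operators -/

namespace PDO

section Additive

variable {B : Type*} [CommRing B]

instance : Zero (PDO B) := ⟨⟨fun _ => 0, 0, fun _ _ => rfl⟩⟩

instance : Add (PDO B) :=
  ⟨fun P Q => ⟨fun k => P.coeff k + Q.coeff k, by
    obtain ⟨N, hN⟩ := P.bounded
    obtain ⟨M, hM⟩ := Q.bounded
    exact ⟨max N M, fun k hk => by
      rw [hN k (lt_of_le_of_lt (le_max_left _ _) hk), hM k (lt_of_le_of_lt (le_max_right _ _) hk),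
        add_zero]⟩⟩⟩

instance : Neg (PDO B) :=
  ⟨fun P => ⟨fun k => -P.coeff k, by
    obtain ⟨N, hN⟩ := P.bounded
    exact ⟨N, fun k hk => by rw [hN k hk, neg_zero]⟩⟩⟩

@[simp] theorem coeff_zero' (k : ℤ) : (0 : PDO B).coeff k = 0 := rfl

@[simp] theorem coeff_add (P Q : PDO B) (k : ℤ) : (P + Q).coeff k = P.coeff k + Q.coeff k := rfl

@[simp] theorem coeff_neg (P : PDO B) (k : ℤ) : (-P).coeff k = -P.coeff k := rfl

instance : AddCommGroup (PDO B) where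
  add_assoc P Q R := by ext k; simp [add_assoc]
  zero_add P := by ext k; simp
  add_zero P := by ext k; simp
  add_comm P Q := by ext k; simp [add_comm]
  neg_add_cancel P := by ext k; simp
  nsmul := nsmulRec
  zsmul := zsmulRec

@[simp] theorem coeff_sub (P Q : PDO B) (k : ℤ) : (P - Q).coeff k = P.coeff k - Q.coeff k := by
  rw [sub_eq_add_neg, coeff_add, coeff_neg, sub_eq_add_neg]

/-- The coefficient of `Dᵏ`, as an additive map. -/
def coeffHom (k : ℤ) : PDO B →+ B where
  toFun P := P.coeff k
  map_zero' := rfl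
  map_add' _ _ := rfl

theorem coeff_sum {ι : Type*} (s : Finset ι) (f : ι → PDO B) (k : ℤ) :
    (∑ i ∈ s, f i).coeff k = ∑ i ∈ s, (f i).coeff k :=
  map_sum (coeffHom k) f s

theorem coeff_mono (a : B) (k l : ℤ) : (mono a k).coeff l = if l = k then a else 0 := rfl

theorem coeff_D (k l : ℤ) : (D k : PDO B).coeff l = if l = k then 1 else 0 := rfl

theorem coeff_ofFun (a : B) (l : ℤ) : (ofFun a).coeff l = if l = 0 then a else 0 := rfl

theorem coeff_posPart (P : PDO B) (k : ℤ) : P.posPart.coeff k = if 0 ≤ k then P.coeff k else 0 :=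
  rfl

theorem coeff_negPart (P : PDO B) (k : ℤ) : P.negPart.coeff k = if 0 ≤ k then 0 else P.coeff k :=
  rfl

theorem posPart_add_negPart (P : PDO B) : P.posPart + P.negPart = P := by
  ext k
  rw [coeff_add, coeff_posPart, coeff_negPart]
  split_ifs <;> simp

@[simp] theorem coeff_map {B' : Type*} [CommRing B'] (φ : B →+* B') (P : PDO B) (k : ℤ) :
    (P.map φ).coeff k = φ (P.coeff k) := rfl

theorem map_D {B' : Type*} [CommRing B'] (φ : B →+* B') (k : ℤ) : (D k).map φ = D k := by
  ext l
  rw [coeff_map, coeff_D, coeff_D]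
  split_ifs <;> simp

theorem map_ofFun {B' : Type*} [CommRing B'] (φ : B →+* B') (a : B) :
    (ofFun a).map φ = ofFun (φ a) := by
  ext l
  rw [coeff_map, coeff_ofFun, coeff_ofFun]
  split_ifs <;> simp

theorem map_posPart {B' : Type*} [CommRing B'] (φ : B →+* B') (P : PDO B) :
    P.posPart.map φ = (P.map φ).posPart := by
  ext l
  rw [coeff_map, coeff_posPart, coeff_posPart, coeff_map]
  split_ifs <;> simp

/-- The product `P D`. -/
def mulD (P : PDO B) : PDO B where
  coeff k := P.coeff (k - 1)
  bounded := by
    obtain ⟨N, hN⟩ := P.bounded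
    exact ⟨N + 1, fun k hk => hN _ (by omega)⟩

theorem coeff_mulD (P : PDO B) (k : ℤ) : P.mulD.coeff k = P.coeff (k - 1) := rfl

/-- Differential operators. -/
def IsDiff (P : PDO B) : Prop := ∀ k < 0, P.coeff k = 0

theorem isDiff_posPart (P : PDO B) : IsDiff P.posPart := fun k hk => by
  rw [coeff_posPart, if_neg (by omega)]

theorem IsDiff.add {P Q : PDO B} (hP : IsDiff P) (hQ : IsDiff Q) : IsDiff (P + Q) :=
  fun k hk => by rw [coeff_add, hP k hk, hQ k hk, add_zero]

theorem isDiff_sum {ι : Type*} {s : Finset ι} {f : ι → PDO B} (h : ∀ i ∈ s, IsDiff (f i)) :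
    IsDiff (∑ i ∈ s, f i) := fun k hk => by
  rw [coeff_sum, sum_eq_zero fun i hi => h i hi k hk]

theorem isDiff_D {k : ℤ} (hk : 0 ≤ k) : IsDiff (D k : PDO B) := fun l hl => by
  rw [coeff_D, if_neg (by omega)]

theorem isDiff_ofFun (a : B) : IsDiff (ofFun a) := fun l hl => by
  rw [coeff_ofFun, if_neg (by omega)]

theorem IsDiff.posPart_eq {P : PDO B} (hP : IsDiff P) : P.posPart = P := by
  ext k
  rw [coeff_posPart]
  split_ifs with h
  · rfl
  · rw [hP k (by omega)]

theorem IsDiff.map {B' : Type*} [CommRing B'] (φ : B →+* B') {P : PDO B} (hP : IsDiff P) :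
    IsDiff (P.map φ) := fun k hk => by
  rw [coeff_map, hP k hk, map_zero]

instance : One (PDO B) := ⟨ofFun 1⟩

theorem one_def : (1 : PDO B) = ofFun 1 := rfl

theorem D_zero : (D 0 : PDO B) = 1 := rfl

/-- Every operator agrees, down to a given order, with a finite sum of monomials. -/
theorem exists_sum_mono (P : PDO B) (c : ℤ) : ∃ (s : Finset ℤ),
    ∀ k, c ≤ k → P.coeff k = (∑ i ∈ s, mono (P.coeff i) i).coeff k := by
  obtain ⟨N, hN⟩ := P.bounded
  refine ⟨Icc c N, fun k hk => ?_⟩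
  rw [coeff_sum]
  simp only [coeff_mono]
  rw [sum_ite_eq]
  split_ifs with h
  · rfl
  · rw [mem_Icc] at h
    exact hN k (by omega)

end Additive

variable {B : Type*} [CommRing B] [Algebra ℚ B] [MultiTimeRing B]

theorem iterate_flow_add (j : ℕ) (a b : B) :
    (flow (B := B) 1)^[j] (a + b) = (flow 1)^[j] a + (flow 1)^[j] b :=
  iterate_map_add (flow (B := B) 1) j a b

theorem flow_iterate_flow (n : ℕ+) (j : ℕ) (a : B) :
    flow n ((flow 1)^[j] a) = (flow 1)^[j] (flow n a) :=
  (Function.Commute.iterate_right (f := flow (B := B) n) (g := flow (B := B) 1)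
    (fun x => MultiTimeRing.flow_comm n 1 x) j) a

theorem coeff_mul (P Q : PDO B) (m : ℤ) : (P * Q).coeff m = ∑ᶠ p : ℤ × ℕ, mulTerm P Q m p := rfl

theorem mul_add' (P Q R : PDO B) : P * (Q + R) = P * Q + P * R := by
  ext m
  rw [coeff_add, coeff_mul, coeff_mul, coeff_mul, ← finsum_add_distrib
    (finite_support_mulTerm P Q m) (finite_support_mulTerm P R m)]
  refine finsum_congr fun p => ?_
  rw [mulTerm, mulTerm, mulTerm, coeff_add, iterate_flow_add, mul_add, smul_add]

theorem add_mul' (P Q R : PDO B) : (P + Q) * R = P * R + Q * R := by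
  ext m
  rw [coeff_add, coeff_mul, coeff_mul, coeff_mul, ← finsum_add_distrib
    (finite_support_mulTerm P R m) (finite_support_mulTerm Q R m)]
  refine finsum_congr fun p => ?_
  rw [mulTerm, mulTerm, mulTerm, coeff_add, add_mul, smul_add]

theorem zero_mul' (P : PDO B) : 0 * P = 0 := by
  ext m
  rw [coeff_mul]
  exact finsum_eq_zero_of_forall_eq_zero fun p => by simp [mulTerm]

theorem mul_zero' (P : PDO B) : P * 0 = 0 := by
  ext m
  rw [coeff_mul]
  exact finsum_eq_zero_of_forall_eq_zero fun p => by simp [mulTerm]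

/-- A coefficient of a product depends only on finitely many coefficients. -/
theorem coeff_mul_congr {P P' Q : PDO B} {M m : ℤ} (hQ : ∀ k, M < k → Q.coeff k = 0)
    (h : ∀ k, m - M ≤ k → P.coeff k = P'.coeff k) : (P * Q).coeff m = (P' * Q).coeff m := by
  rw [coeff_mul, coeff_mul]
  refine finsum_congr fun p => ?_
  rw [mulTerm, mulTerm]
  by_cases hp : m - M ≤ p.1
  · rw [h _ hp]
  · rw [hQ (m + p.2 - p.1) (by omega), iterate_flow_zero, mul_zero, mul_zero]

theorem coeff_mul_eq_sum {P Q : PDO B} {N M c m : ℤ} {J : ℕ} (hP : ∀ k, N < k → P.coeff k = 0)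
    (hQ : ∀ k, M < k → Q.coeff k = 0) (hc : c ≤ m - M) (hJ : N + M - m < J) :
    (P * Q).coeff m = ∑ k ∈ Icc c N, ∑ j ∈ range J,
      Ring.choose k j • (P.coeff k * (flow 1)^[j] (Q.coeff (m + j - k))) := by
  rw [coeff_mul, finsum_eq_sum_of_support_subset (s := Icc c N ×ˢ range J), sum_product]
  · rfl
  · rintro ⟨k, j⟩ hkj
    have h1 : k ≤ N := by
      by_contra h
      exact hkj (by simp [mulTerm, hP k (by omega)])
    have h2 : m + j - k ≤ M := by
      by_contra h
      exact hkj (by simp [mulTerm, hQ (m + j - k) (by omega)])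
    simp only [coe_product, Set.mem_prod, SetLike.mem_coe, mem_Icc, mem_range]
    omega

theorem coeff_mono_mul {Q : PDO B} {M k m : ℤ} {J : ℕ} (a : B)
    (hQ : ∀ k, M < k → Q.coeff k = 0) (hJ : k + M - m < J) :
    (mono a k * Q).coeff m = ∑ j ∈ range J,
      Ring.choose k j • (a * (flow 1)^[j] (Q.coeff (m + j - k))) := by
  rw [coeff_mul_eq_sum (N := k) (M := M) (c := min k (m - M)) (J := J)
    (fun l hl => if_neg (by omega)) hQ (min_le_right _ _) hJ, sum_eq_single k]
  · simp [coeff_mono]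
  · intro l _ hl
    refine sum_eq_zero fun j _ => ?_
    rw [coeff_mono, if_neg hl, zero_mul, smul_zero]
  · intro h
    exact absurd (mem_Icc.2 ⟨min_le_left _ _, le_refl k⟩) h

theorem mono_mul (a : B) (k : ℤ) (Q : PDO B) : mono a k * Q = ofFun a * (D k * Q) := by
  ext m
  obtain ⟨M, hM⟩ := Q.bounded
  obtain ⟨M', hM'⟩ := (D k * Q).bounded
  rw [ofFun, coeff_mono_mul a hM' (J := (M' - m).toNat + 1) (by omega), sum_range_succ',
    sum_eq_zero, D, coeff_mono_mul a hM (J := (k + M - m).toNat + 1) (by omega)]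
  · simp only [Ring.choose_zero_right, one_smul, Function.iterate_zero, id, zero_add]
    rw [show m + ((0 : ℕ) : ℤ) - 0 = m by simp,
      coeff_mono_mul 1 hM (J := (k + M - m).toNat + 1) (by omega), mul_sum]
    exact sum_congr rfl fun j _ => by rw [one_mul, mul_smul_comm]
  · intro j _
    rw [Ring.choose_zero_succ, zero_smul]

theorem coeff_ofFun_mul (a : B) (Q : PDO B) (m : ℤ) : (ofFun a * Q).coeff m = a * Q.coeff m := by
  obtain ⟨M, hM⟩ := Q.bounded
  rw [ofFun, coeff_mono_mul a hM (J := (M - m).toNat + 1) (by omega), sum_range_succ',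
    sum_eq_zero]
  · simp
  · intro j _
    rw [Ring.choose_zero_succ, zero_smul]

theorem ofFun_mul_assoc (a : B) (Q R : PDO B) : ofFun a * Q * R = ofFun a * (Q * R) := by
  ext m
  rw [coeff_ofFun_mul, coeff_mul, coeff_mul, mul_finsum' _ _ (finite_support_mulTerm Q R m)]
  refine finsum_congr fun p => ?_
  rw [mulTerm, mulTerm, coeff_ofFun_mul, mul_smul_comm, mul_assoc]

theorem one_mul' (Q : PDO B) : ofFun 1 * Q = Q := by
  ext m
  rw [coeff_ofFun_mul, one_mul]

/-- A flow, acting on the coefficients. -/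
def deriv (n : ℕ+) (P : PDO B) : PDO B where
  coeff k := flow n (P.coeff k)
  bounded := by
    obtain ⟨N, hN⟩ := P.bounded
    exact ⟨N, fun k hk => by rw [hN k hk, map_zero]⟩

@[simp] theorem coeff_deriv (n : ℕ+) (P : PDO B) (k : ℤ) :
    (deriv n P).coeff k = flow n (P.coeff k) := rfl

theorem deriv_mul (n : ℕ+) (P Q : PDO B) : deriv n (P * Q) = deriv n P * Q + P * deriv n Q := by
  ext m
  rw [coeff_deriv, coeff_add, coeff_mul, coeff_mul, coeff_mul, ← finsum_add_distrib
    (finite_support_mulTerm _ Q m) (finite_support_mulTerm P _ m)]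
  refine ((flow (B := B) n : B →ₗ[ℚ] B).toAddMonoidHom.map_finsum
    (finite_support_mulTerm P Q m)).trans (finsum_congr fun p => ?_)
  change flow n (mulTerm P Q m p) = _
  rw [mulTerm, mulTerm, mulTerm, map_zsmul, Derivation.leibniz, flow_iterate_flow, coeff_deriv,
    coeff_deriv, smul_eq_mul, smul_eq_mul, ← smul_add, add_comm, mul_comm (flow n _)]

/-- The commutation rule `D P = P D + ∂P` for `P = Dᵏ Q`, valid also for negative `k`: it is
Pascal's rule for the generalized binomial coefficients. -/
theorem D_succ_mul (k : ℤ) (Q : PDO B) :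
    D (k + 1) * Q = (D k * Q).mulD + deriv 1 (D k * Q) := by
  ext m
  obtain ⟨M, hM⟩ := Q.bounded
  rw [coeff_add, coeff_mulD, coeff_deriv, D, D,
    coeff_mono_mul 1 hM (J := (k + 1 + M - m).toNat + 1 + 1) (by omega),
    coeff_mono_mul 1 hM (m := m - 1) (J := (k + 1 + M - m).toNat + 1 + 1) (by omega),
    coeff_mono_mul 1 hM (m := m) (J := (k + 1 + M - m).toNat + 1) (by omega), map_sum,
    sum_range_succ', sum_range_succ' (n := (k + 1 + M - m).toNat + 1), add_right_comm (Finset.sum _ _),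
    ← sum_add_distrib]
  congr 1
  · refine sum_congr rfl fun j _ => ?_
    rw [Ring.choose_succ_succ, map_zsmul, one_mul, one_mul, one_mul, ← Function.iterate_succ_apply'
      (flow (B := B) 1), add_smul, add_comm]
    congr 4 <;> push_cast <;> ring_nf
  · rw [Ring.choose_zero_right, Ring.choose_zero_right]
    congr 4
    push_cast
    ring

theorem D_one_mul (Q : PDO B) : D 1 * Q = Q.mulD + deriv 1 Q := by
  have := D_succ_mul 0 Q
  rwa [zero_add, show (D 0 : PDO B) = ofFun 1 from rfl, one_mul'] at this

theorem D_succ_mul' (k : ℤ) (Q : PDO B) : D (k + 1) * Q = D 1 * (D k * Q) := by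
  rw [D_succ_mul, D_one_mul]

theorem mulD_mul (Q R : PDO B) : Q.mulD * R = Q * (D 1 * R) := by
  ext m
  obtain ⟨N, hN⟩ := Q.bounded
  obtain ⟨M, hM⟩ := R.bounded
  set J := (N + 1 + M - m).toNat + 1 with hJ
  rw [D_one_mul, mul_add', coeff_add,
    coeff_mul_eq_sum (P := Q.mulD) (N := N + 1) (M := M) (c := m - M - 1 + 1) (J := J + 1)
      (fun k hk => hN _ (by omega)) hM (by omega) (by omega),
    coeff_mul_eq_sum (P := Q) (Q := R.mulD) (N := N) (M := M + 1) (c := m - M - 1) (J := J + 1)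
      hN (fun k hk => hM _ (by omega)) (by omega) (by omega),
    coeff_mul_eq_sum (P := Q) (Q := deriv 1 R) (N := N) (M := M) (c := m - M - 1) (J := J)
      hN (fun k hk => by rw [coeff_deriv, hM k hk, map_zero]) (by omega) (by omega),
    ← sum_add_distrib, ← map_add_right_Icc, sum_map]
  refine sum_congr rfl fun k _ => ?_
  rw [sum_range_succ', sum_range_succ' (n := J), add_right_comm (Finset.sum _ _), ← sum_add_distrib]
  simp only [addRightEmbedding_apply, coeff_mulD, add_sub_cancel_right, coeff_deriv,
    Ring.choose_zero_right]
  congr 1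
  · refine sum_congr rfl fun j _ => ?_
    rw [Ring.choose_succ_succ, ← Function.iterate_succ_apply, add_smul, add_comm]
    congr 5 <;> push_cast <;> ring
  · congr 4
    push_cast
    ring

/-- The coefficient of `Dᵏ⁺¹` in `D Q` is `Q_k + ∂Q_{k+1}`, so vanishing propagates downwards from
the order bound. -/
theorem eq_zero_of_D_one_mul_eq_zero {Q : PDO B} (h : D 1 * Q = 0) : Q = 0 := by
  obtain ⟨N, hN⟩ := Q.bounded
  have key : ∀ i : ℕ, ∀ k : ℤ, N - i < k → Q.coeff k = 0 := by
    intro i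
    induction i with
    | zero => intro k hk; exact hN k (by simpa using hk)
    | succ i ih =>
      intro k hk
      have h1 := congrArg (fun P => P.coeff (k + 1)) h
      simp only [D_one_mul, coeff_add, coeff_mulD, coeff_deriv, add_sub_cancel_right,
        coeff_zero'] at h1
      rwa [ih (k + 1) (by push_cast at hk; omega), map_zero, add_zero] at h1
  ext k
  exact key (N - k + 1).toNat k (by omega)

theorem D_one_mul_assoc (Q R : PDO B) : D 1 * Q * R = D 1 * (Q * R) := by
  rw [D_one_mul, D_one_mul (Q * R), add_mul', deriv_mul, mulD_mul, D_one_mul, mul_add',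
    add_assoc, add_comm (Q * deriv 1 R)]
  congr 1
  ext m
  rw [coeff_mulD, coeff_mul, coeff_mul]
  refine finsum_congr fun p => ?_
  rw [mulTerm, mulTerm, coeff_mulD]
  congr 4
  ring

theorem D_one_mul_D_neg_one_mul (Q : PDO B) : D 1 * (D (-1) * Q) = Q := by
  rw [← D_succ_mul', neg_add_cancel, show (D 0 : PDO B) = ofFun 1 from rfl, one_mul']

theorem D_one_mul_injective {Q R : PDO B} (h : D 1 * Q = D 1 * R) : Q = R := by
  refine sub_eq_zero.1 (eq_zero_of_D_one_mul_eq_zero ?_)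
  have h1 : D 1 * (Q - R) + D 1 * R = D 1 * Q := by rw [← mul_add', sub_add_cancel]
  rw [h] at h1
  exact add_eq_right.1 h1

/-- Nonnegative powers follow from the case of `D` itself; negative powers are reached by cancelling
`D` on the left. -/
theorem D_mul_assoc (k : ℤ) (Q R : PDO B) : D k * Q * R = D k * (Q * R) := by
  induction k using Int.induction_on with
  | zero => rw [show (D 0 : PDO B) = ofFun 1 from rfl, ofFun_mul_assoc]
  | succ k ih => rw [D_succ_mul', D_one_mul_assoc, ih, D_succ_mul']
  | pred k ih =>
    refine D_one_mul_injective ?_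
    rw [← D_one_mul_assoc, ← D_succ_mul', ← D_succ_mul', sub_add_cancel, ih]

theorem sum_mul' {ι : Type*} (s : Finset ι) (f : ι → PDO B) (Q : PDO B) :
    (∑ i ∈ s, f i) * Q = ∑ i ∈ s, f i * Q := by
  classical
  induction s using Finset.induction_on with
  | empty => simp [zero_mul']
  | insert a s ha ih => rw [sum_insert ha, sum_insert ha, add_mul', ih]

/-- A given coefficient sees only finitely many coefficients of `P`, so `P` may be replaced by a
finite sum of monomials `a Dᵏ`, for which associativity is known. -/
theorem mul_assoc' (P Q R : PDO B) : P * Q * R = P * (Q * R) := by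
  ext m
  obtain ⟨M, hM⟩ := Q.bounded
  obtain ⟨K, hK⟩ := R.bounded
  obtain ⟨L, hL⟩ := (Q * R).bounded
  -- The cutoff `m - L` serves `P (Q R)`, and `m - K - M` serves `(P Q) R`.
  obtain ⟨s, hs⟩ := exists_sum_mono P (min (m - L) (m - K - M))
  set P' := ∑ i ∈ s, mono (P.coeff i) i with hP'
  have h1 : (P * Q * R).coeff m = (P' * Q * R).coeff m :=
    coeff_mul_congr hK fun k hk => coeff_mul_congr hM fun l hl => hs l (by omega)
  have h2 : (P * (Q * R)).coeff m = (P' * (Q * R)).coeff m :=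
    coeff_mul_congr hL fun l hl => hs l (by omega)
  rw [h1, h2, hP', sum_mul', sum_mul', sum_mul']
  simp only [mono_mul, ofFun_mul_assoc, D_mul_assoc]

theorem iterate_flow_one (j : ℕ) (hj : j ≠ 0) : (flow (B := B) 1)^[j] 1 = 0 := by
  obtain ⟨j, rfl⟩ := Nat.exists_eq_succ_of_ne_zero hj
  rw [Function.iterate_succ_apply, Derivation.map_one_eq_zero, iterate_flow_zero]

theorem coeff_mul_D (P : PDO B) (n m : ℤ) : (P * D n).coeff m = P.coeff (m - n) := by
  rw [coeff_mul, finsum_eq_single _ (m - n, 0)]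
  · rw [mulTerm, coeff_D, if_pos (by push_cast; ring)]
    simp
  · rintro ⟨k, j⟩ h
    rw [mulTerm, coeff_D]
    split_ifs with h'
    · rw [iterate_flow_one, mul_zero, smul_zero]
      rintro rfl
      refine h ?_
      simp only [Prod.mk.injEq, and_true]
      push_cast at h'
      omega
    · rw [iterate_flow_zero, mul_zero, smul_zero]

instance : Ring (PDO B) where
  left_distrib := mul_add'
  right_distrib := add_mul'
  zero_mul := zero_mul'
  mul_zero := mul_zero'
  mul_assoc := mul_assoc'
  one_mul := one_mul'
  mul_one P := by
    ext m
    change (P * D 0).coeff m = _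
    rw [coeff_mul_D, sub_zero]
  zsmul := zsmulRec
  neg_add_cancel := neg_add_cancel

theorem D_mul_D (k l : ℤ) : (D k * D l : PDO B) = D (k + l) := by
  ext m
  rw [coeff_mul_D, coeff_D, coeff_D]
  congr 1
  exact propext (by omega)

theorem ofFun_mul_ofFun (a b : B) : ofFun a * ofFun b = ofFun (a * b) := by
  ext m
  rw [coeff_ofFun_mul, coeff_ofFun, coeff_ofFun]
  split_ifs <;> simp

theorem res_D_one_mul (X : PDO B) : (D 1 * X).res = (X * D 1).res + flow 1 X.res := by
  rw [res, res, res, coeff_mul_D, D_one_mul, coeff_add, coeff_mulD, coeff_deriv]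

theorem res_mul_ofFun (X : PDO B) (a : B) : (X * ofFun a).res = X.res * a := by
  rw [res, res, coeff_mul, finsum_eq_single _ (-1, 0)]
  · simp [mulTerm, coeff_ofFun]
  · rintro ⟨k, j⟩ h
    rw [mulTerm, coeff_ofFun]
    split_ifs with h'
    · dsimp only at h' ⊢
      rcases lt_or_ge k 0 with hk | hk
      -- Here `j = k + 1`, so `k < 0` allows only `k = -1`, `j = 0`; for `k ≥ 0` the binomial
      -- coefficient vanishes.
      · refine absurd ?_ h
        ext <;> simp only <;> omega
      · obtain ⟨k, rfl⟩ := Int.eq_ofNat_of_zero_le hk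
        rw [Ring.choose_natCast, Nat.choose_eq_zero_of_lt (by omega), Nat.cast_zero, zero_smul]
    · rw [iterate_flow_zero, mul_zero, smul_zero]

theorem IsDiff.mul {P Q : PDO B} (hP : IsDiff P) (hQ : IsDiff Q) : IsDiff (P * Q) := by
  intro m hm
  rw [coeff_mul]
  refine finsum_eq_zero_of_forall_eq_zero ?_
  rintro ⟨k, j⟩
  rw [mulTerm]
  by_cases hk : k < 0
  · rw [hP k hk, zero_mul, smul_zero]
  · by_cases hl : m + j - k < 0
    · rw [hQ _ hl, iterate_flow_zero, mul_zero, smul_zero]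
    · obtain ⟨k, rfl⟩ := Int.eq_ofNat_of_zero_le (not_lt.1 hk)
      rw [Ring.choose_natCast, Nat.choose_eq_zero_of_lt (by omega), Nat.cast_zero, zero_smul]

theorem IsDiff.deriv {P : PDO B} (hP : IsDiff P) (n : ℕ+) : IsDiff (P.deriv n) := fun k hk => by
  rw [coeff_deriv, hP k hk, map_zero]

section Map

variable {B' : Type*} [CommRing B'] [Algebra ℚ B'] [MultiTimeRing B'] {φ : B →+* B'}

theorem map_iterate_flow (h : IsFlowHom φ) (j : ℕ) (b : B) :
    φ ((flow 1)^[j] b) = (flow 1)^[j] (φ b) := by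
  induction j with
  | zero => rfl
  | succ j ih => rw [Function.iterate_succ_apply', Function.iterate_succ_apply', h, ih]

theorem map_mul' (h : IsFlowHom φ) (P Q : PDO B) : (P * Q).map φ = P.map φ * Q.map φ := by
  ext m
  rw [coeff_map, coeff_mul, coeff_mul]
  refine (φ.toAddMonoidHom.map_finsum (finite_support_mulTerm P Q m)).trans
    (finsum_congr fun p => ?_)
  change φ (mulTerm P Q m p) = _
  rw [mulTerm, mulTerm, map_zsmul, map_mul, map_iterate_flow h, coeff_map, coeff_map]

end Map

end PDO

end KP

end

noncomputable section

namespace KP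

open Finset

/-! ### Schur operators on operator coefficients, and the discrete flow `t ↦ t - [X]` -/

section SchurRecurrence

variable {B : Type*} [CommRing B] [Algebra ℚ B] [MultiTimeRing B]

theorem schurOp_succ (ε : ℚ) (n : ℕ) (f : B) :
    (n + 1) • schurOp ε (n + 1) f =
      ε • ∑ p ∈ antidiagonal n, flow p.1.succPNat (schurOp ε p.2 f) := by
  have h := schurOp_recurrence ε (n + 1) f
  rw [Nat.cast_smul_eq_nsmul, Nat.sum_antidiagonal_succ] at h
  rw [h]
  congr 1
  simp only [flowNat]
  simp
  rfl

theorem schurOp_one (ε : ℚ) (f : B) : schurOp ε 1 f = ε • flow 1 f := by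
  have h := schurOp_succ ε 0 f
  simp only [zero_add, one_smul, Finset.Nat.antidiagonal_zero, sum_singleton, schurOp_zero] at h
  exact h

theorem schurOp_succ_one (ε : ℚ) (n : ℕ) : schurOp ε (n + 1) (1 : B) = 0 := by
  rw [← coeff_psShift, map_one, PowerSeries.coeff_one, if_neg (by omega)]

end SchurRecurrence

namespace PDO

variable {B : Type*} [CommRing B] [Algebra ℚ B] [MultiTimeRing B]

/-- `pₙ(ε[∂])` acting on the coefficients of an operator. -/
def schur (ε : ℚ) (n : ℕ) (P : PDO B) : PDO B where
  coeff k := schurOp ε n (P.coeff k)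
  bounded := by
    obtain ⟨N, hN⟩ := P.bounded
    exact ⟨N, fun k hk => by rw [hN k hk, map_zero]⟩

@[simp] theorem coeff_schur (ε : ℚ) (n : ℕ) (P : PDO B) (k : ℤ) :
    (P.schur ε n).coeff k = schurOp ε n (P.coeff k) := rfl

theorem schur_zero (ε : ℚ) (P : PDO B) : P.schur ε 0 = P := by
  ext k
  rw [coeff_schur, schurOp_zero]

theorem coeff_nsmul (n : ℕ) (P : PDO B) (k : ℤ) : (n • P).coeff k = n • P.coeff k :=
  map_nsmul (coeffHom k) n P

theorem schur_neg_one_succ (n : ℕ) (P : PDO B) :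
    (n + 1) • P.schur (-1) (n + 1) =
      -∑ p ∈ antidiagonal n, (P.schur (-1) p.2).deriv p.1.succPNat := by
  ext k
  rw [coeff_nsmul, coeff_schur, schurOp_succ, coeff_neg, coeff_sum, neg_smul, one_smul]
  rfl

theorem deriv_sub (n : ℕ+) (P Q : PDO B) : (P - Q).deriv n = P.deriv n - Q.deriv n := by
  ext k; simp

theorem deriv_D (n : ℕ+) (k : ℤ) : (D k : PDO B).deriv n = 0 := by
  ext l
  rw [coeff_deriv, coeff_D]
  split_ifs <;> simp

/-- The operator on symbols corresponding to `∂/∂tₙ` acting on `P(e^ξ)`. -/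
def nabla (n : ℕ+) (P : PDO B) : PDO B := P.deriv n + P * D n

theorem nabla_mul (n : ℕ+) (P Q : PDO B) : nabla n (P * Q) = P.deriv n * Q + P * nabla n Q := by
  rw [nabla, nabla, deriv_mul, mul_add, mul_assoc, add_assoc]

/-- The coefficients of `P(t - [X⁻¹]) (1 - X D)` in powers of `X`. -/
def discrete (P : PDO B) : ℕ → PDO B
  | 0 => P
  | n + 1 => P.schur (-1) (n + 1) - P.schur (-1) n * D 1

/-- On symbols, `e^{ξ(t - [X], z)} = e^{ξ(t,z)} (1 - zX)`, so `discrete` lists the coefficients of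
the shifted function `P(e^ξ)`. They obey the Schur recurrence with `∂ₗ` replaced by its action
`nabla` on such functions. -/
theorem discrete_succ (P : PDO B) (n : ℕ) :
    (n + 1) • P.discrete (n + 1) =
      -∑ p ∈ antidiagonal n, nabla p.1.succPNat (P.discrete p.2) := by
  set σ := fun m => P.schur (-1) m with hσ
  have hrec : ∀ m, (m + 1) • σ (m + 1) = -∑ p ∈ antidiagonal m, (σ p.2).deriv p.1.succPNat :=
    fun m => schur_neg_one_succ m P
  have h0 : σ 0 = P := schur_zero _ P
  change (n + 1) • (σ (n + 1) - σ n * D 1) = _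
  rcases n with _ | n
  · have h1 := hrec 0
    simp only [zero_add, one_smul, Finset.Nat.antidiagonal_zero, sum_singleton, h0] at h1
    simp only [zero_add, one_smul, Finset.Nat.antidiagonal_zero, sum_singleton, h0, h1, discrete, nabla]
    change -P.deriv (Nat.succPNat 0) - P * D 1 = -(P.deriv (Nat.succPNat 0) + P * D 1)
    abel
  · have e1 := hrec (n + 1)
    have e2 := hrec n
    rw [Nat.sum_antidiagonal_succ'] at e1 ⊢
    simp only at e1 ⊢
    have hd : ∀ a b : ℕ, nabla a.succPNat (P.discrete (b + 1)) =
        (σ (b + 1)).deriv a.succPNat - (σ b).deriv a.succPNat * D 1 +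
          (σ (b + 1) * D (a + 1) - σ b * D ((a + 1 : ℕ) + 1)) := by
      intro a b
      change nabla a.succPNat (σ (b + 1) - σ b * D 1) = _
      rw [nabla, deriv_sub, deriv_mul, deriv_D, mul_zero, add_zero, sub_mul, mul_assoc, D_mul_D,
        Nat.succPNat_coe, Nat.succ_eq_add_one, add_comm (1 : ℤ)]
      push_cast
      rfl
    -- The terms coming from the right factors `Dˡ` in `nabla` telescope; the term with `discrete 0
    -- = P` is the boundary term, as it lacks the `- σ D` part.
    have htel : ∑ p ∈ antidiagonal n, σ p.2 * D ((p.1 + 1 : ℕ) + 1) + σ (n + 1) * D 1 =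
        ∑ p ∈ antidiagonal n, σ (p.2 + 1) * D (p.1 + 1) + P * D ((n + 1 : ℕ) + 1) := by
      have t1 := Nat.sum_antidiagonal_succ (n := n)
        (f := fun p => σ p.2 * D ((p.1 : ℤ) + 1))
      have t2 := Nat.sum_antidiagonal_succ' (n := n)
        (f := fun p => σ p.2 * D ((p.1 : ℤ) + 1))
      rw [t2] at t1
      simp only [h0, Nat.cast_zero, zero_add] at t1
      rw [add_comm, ← t1, add_comm]
    simp only [hd, sum_add_distrib, sum_sub_distrib, ← sum_mul]
    rw [smul_sub, e1, ← smul_mul_assoc, add_smul (n + 1), e2, one_smul, add_mul, nabla]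
    change _ = -(P.deriv (n + 1).succPNat + P * D ((n + 1 : ℕ) + 1) + _)
    rw [h0, eq_sub_of_add_eq' htel]
    simp only [neg_mul]
    abel

/-- A right factor of order zero with leading coefficient one does not change leading
coefficients. -/
theorem coeff_mul_monic {W X : PDO B} (h0 : W.coeff 0 = 1) (hpos : ∀ k, 0 < k → W.coeff k = 0)
    {N : ℤ} (hX : ∀ k, N < k → X.coeff k = 0) : (X * W).coeff N = X.coeff N := by
  rw [coeff_mul_eq_sum (c := N) (J := 1) hX hpos (by omega) (by omega)]
  simp [h0]

/-- `X` and `X W` have the same leading coefficient; descend from the order bound of `X`. -/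
theorem coeff_eq_zero_of_mul_monic {W X : PDO B} (h0 : W.coeff 0 = 1)
    (hpos : ∀ k, 0 < k → W.coeff k = 0) {M : ℤ} (h : ∀ k, M < k → (X * W).coeff k = 0) :
    ∀ k, M < k → X.coeff k = 0 := by
  obtain ⟨N, hN⟩ := X.bounded
  have key : ∀ i : ℕ, ∀ k : ℤ, N - i < k → M < k → X.coeff k = 0 := by
    intro i
    induction i with
    | zero => intro k hk _; exact hN k (by simpa using hk)
    | succ i ih =>
      intro k hk hM
      rw [← coeff_mul_monic h0 hpos fun l hl => ih l (by push_cast at hk; omega) (by omega),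
        h k hM]
  exact fun k hk => key (N - k + 1).toNat k (by omega) hk

end PDO

/-! ### Wilson–Sato equations and the linear problem of the discrete shift -/

section Dressing

variable {A : Type*} [CommRing A] [Algebra ℚ A] [MultiTimeRing A] {W V : PDO A}

open PDO

theorem IsDressing.laxPow_mul (hW : IsDressing W V) (n : ℕ+) : laxPow W V n * W = W * D n := by
  rw [laxPow, mul_assoc, mul_assoc, hW.inv_mul, ← one_def, mul_one]

theorem IsDressing.deriv_eq (hW : IsDressing W V) (n : ℕ+) :
    W.deriv n = -((laxPow W V n).negPart * W) := by
  ext k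
  exact hW.wilson_sato n k

/-- The linear problem `∂ₙψ = (L^{n/r})₊ ψ` in operator form: the term `W Dⁿ = L^{n/r} W` combines
with `∂ₙW = -(L^{n/r})₋ W`. -/
theorem IsDressing.nabla_eq (hW : IsDressing W V) (n : ℕ+) :
    nabla n W = (laxPow W V n).posPart * W := by
  rw [nabla, hW.deriv_eq, ← hW.laxPow_mul, neg_add_eq_sub, ← sub_mul]
  congr 1
  rw [sub_eq_iff_eq_add, PDO.posPart_add_negPart]

/-- The left module of differential operators times `W` is stable under the flows. -/
theorem IsDressing.exists_nabla (hW : IsDressing W V) (n : ℕ+) {X : PDO A}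
    (hX : ∃ P : PDO A, P.IsDiff ∧ X = P * W) : ∃ P : PDO A, P.IsDiff ∧ nabla n X = P * W := by
  obtain ⟨P, hP, rfl⟩ := hX
  refine ⟨P.deriv n + P * (laxPow W V n).posPart, (hP.deriv n).add (hP.mul (isDiff_posPart _)), ?_⟩
  rw [nabla_mul, hW.nabla_eq, add_mul, mul_assoc]

theorem IsDressing.exists_discrete (hW : IsDressing W V) (n : ℕ) :
    ∃ P : PDO A, P.IsDiff ∧ W.discrete n = P * W := by
  induction n using Nat.strong_induction_on with
  | _ n ih =>
    rcases n with _ | n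
    · exact ⟨1, isDiff_ofFun 1, (one_mul W).symm⟩
    · have h : ∀ p ∈ antidiagonal n, ∃ P : PDO A, P.IsDiff ∧
          nabla p.1.succPNat (W.discrete p.2) = P * W := fun p hp =>
        hW.exists_nabla _ (ih p.2 (by rw [HasAntidiagonal.mem_antidiagonal] at hp; omega))
      choose! P hP hPW using h
      -- The constant `-(n + 1)⁻¹` undoes the factor `n + 1` and the sign of `discrete_succ`.
      refine ⟨ofFun (algebraMap ℚ A (-((n : ℚ) + 1)⁻¹)) * ∑ p ∈ antidiagonal n, P p,
        (isDiff_ofFun _).mul (isDiff_sum hP), ?_⟩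
      have h1 : W.discrete (n + 1) =
          ofFun (algebraMap ℚ A (((n : ℚ) + 1)⁻¹)) * ((n + 1) • W.discrete (n + 1)) := by
        ext k
        rw [coeff_ofFun_mul, coeff_nsmul, nsmul_eq_mul, ← mul_assoc, ← map_natCast (algebraMap ℚ A),
          ← map_mul]
        rw [Nat.cast_add, Nat.cast_one, inv_mul_cancel₀ (by positivity), map_one, one_mul]
      have h2 : ∑ p ∈ antidiagonal n, nabla p.1.succPNat (W.discrete p.2) =
          ∑ p ∈ antidiagonal n, P p * W := sum_congr rfl hPW
      rw [h1, discrete_succ, h2, ← sum_mul, mul_assoc]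
      ext k
      rw [coeff_ofFun_mul, coeff_ofFun_mul, coeff_neg, map_neg, neg_mul, mul_neg]

/-- The coefficient `discrete (n + 2)` is `P W` with `P` differential. Its positive coefficients
vanish because Schur operators of positive index kill the leading coefficient `1` of `W`, so `P` is
a function, read off from the coefficient of `D⁰`. For index `1` this fails, which is why the
statement starts at `n + 2`. -/
theorem IsDressing.schurOp_coeff (hW : IsDressing W V) (n : ℕ) (k : ℤ) :
    schurOp (-1) (n + 2) (W.coeff k) - schurOp (-1) (n + 1) (W.coeff (k - 1)) =
      -schurOp (-1) (n + 1) (W.coeff (-1)) * W.coeff k := by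
  obtain ⟨P, hP, hPW⟩ := hW.exists_discrete (n + 2)
  have hc : ∀ k, (P * W).coeff k =
      schurOp (-1) (n + 2) (W.coeff k) - schurOp (-1) (n + 1) (W.coeff (k - 1)) := by
    intro k
    rw [← hPW, discrete, coeff_sub, coeff_mul_D]
    rfl
  have hpos : ∀ k, 0 < k → (P * W).coeff k = 0 := by
    intro k hk
    rw [hc, hW.coeff_pos k hk, map_zero, zero_sub, neg_eq_zero]
    rcases eq_or_lt_of_le (show 1 ≤ k by omega) with h | h
    · rw [← h, sub_self, hW.coeff_zero, schurOp_succ_one]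
    · rw [hW.coeff_pos _ (by omega), map_zero]
  have hP' := coeff_eq_zero_of_mul_monic hW.coeff_zero hW.coeff_pos hpos
  have hP0 := coeff_mul_monic hW.coeff_zero hW.coeff_pos hP'
  rw [hc, hW.coeff_zero, schurOp_succ_one, zero_sub, zero_sub] at hP0
  have hPe : P = ofFun (-schurOp (-1) (n + 1) (W.coeff (-1))) := by
    ext l
    rw [coeff_ofFun]
    split_ifs with h
    · rw [h, hP0]
    · rcases lt_or_gt_of_ne h with h | h
      · exact hP l h
      · exact hP' l h
  rw [← hc, hPe, coeff_ofFun_mul]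

/-- The series `1 + ∑ₙ wₙ Xⁿ` of a dressing operator `1 + ∑ₙ wₙ D⁻ⁿ`. -/
def symbolSeries (W : PDO A) : PowerSeries A := PowerSeries.mk fun i => W.coeff (-i)

/-- The linear problem of the shift `t ↦ t - [Y]`. -/
theorem IsDressing.psShift_symbolSeries (hW : IsDressing W V) :
    (PowerSeries.C PowerSeries.X - PowerSeries.X) * psShift (-1) (symbolSeries W) =
      (PowerSeries.C PowerSeries.X - PowerSeries.X) * PowerSeries.C (symbolSeries W) -
        PowerSeries.C PowerSeries.X * PowerSeries.X * PowerSeries.C (flow 1 (symbolSeries W)) -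
        PowerSeries.C PowerSeries.X * PowerSeries.X *
          (psShift (-1) (PowerSeries.C (W.coeff (-1))) -
            PowerSeries.C (PowerSeries.C (W.coeff (-1)))) * PowerSeries.C (symbolSeries W) := by
  have hs : ∀ n i, PowerSeries.coeff i (schurOp (-1) n (symbolSeries W)) =
      schurOp (-1) n (W.coeff (-i)) := by
    intro n i
    rw [← coeff_psShift, coeff_psShift_powerSeries, symbolSeries, PowerSeries.coeff_mk]
  have hc : ∀ n, schurOp (-1) n (PowerSeries.C (W.coeff (-1))) =
      PowerSeries.C (schurOp (-1) n (W.coeff (-1))) := by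
    intro n
    rw [← coeff_psShift, ← isFlowHom_C.map_psShift, PowerSeries.coeff_map, coeff_psShift]
  have c0 : ∀ (x : PowerSeries A) (s : PowerSeries (PowerSeries A)),
      PowerSeries.coeff 0 ((PowerSeries.C x - PowerSeries.X) * s) = x * PowerSeries.coeff 0 s := by
    intro x s
    simp [sub_mul]
  have c1 : ∀ (x : PowerSeries A) (s : PowerSeries (PowerSeries A)) (n : ℕ),
      PowerSeries.coeff (n + 1) ((PowerSeries.C x - PowerSeries.X) * s) =
        x * PowerSeries.coeff (n + 1) s - PowerSeries.coeff n s := by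
    intro x s n
    rw [sub_mul, map_sub, PowerSeries.coeff_C_mul, PowerSeries.coeff_succ_X_mul]
  have d0 : ∀ (x : PowerSeries A) (s : PowerSeries (PowerSeries A)),
      PowerSeries.coeff 0 (PowerSeries.C x * PowerSeries.X * s) = 0 := by
    intro x s
    simp
  have d1 : ∀ (x : PowerSeries A) (s : PowerSeries (PowerSeries A)) (n : ℕ),
      PowerSeries.coeff (n + 1) (PowerSeries.C x * PowerSeries.X * s) =
        x * PowerSeries.coeff n s := by
    intro x s n
    rw [mul_assoc, PowerSeries.coeff_C_mul, PowerSeries.coeff_succ_X_mul]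
  ext1 n
  rw [mul_assoc (PowerSeries.C PowerSeries.X * PowerSeries.X) (_ - _), map_sub, map_sub]
  -- The powers of the outer variable `Y`: `Y⁰` is trivial, `Y¹` uses only that the first Schur
  -- operator is `-∂ₓ`, and all higher ones are `schurOp_coeff`.
  rcases n with _ | _ | n
  · rw [c0, c0, d0, d0, coeff_psShift, schurOp_zero, PowerSeries.coeff_C, if_pos rfl, sub_zero,
      sub_zero]
  · rw [c1, c1, d1, d1, PowerSeries.coeff_mul_C, map_sub]
    simp only [coeff_psShift, schurOp_zero, zero_add, schurOp_one, PowerSeries.coeff_C, if_true,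
      one_ne_zero, if_false]
    simp
    ring
  · rw [c1, c1, d1, d1, PowerSeries.coeff_mul_C, map_sub]
    simp only [coeff_psShift, PowerSeries.coeff_C, hc, Nat.add_eq_zero_iff, one_ne_zero, and_false,
      if_false, mul_zero, sub_zero, zero_sub]
    ext i
    rcases i with _ | i
    · rw [map_sub, map_neg, PowerSeries.coeff_zero_X_mul, PowerSeries.coeff_zero_X_mul, hs]
      simp [hW.coeff_zero, schurOp_succ_one]
    · have h := hW.schurOp_coeff n (-i)
      rw [map_sub, map_neg, PowerSeries.coeff_succ_X_mul, PowerSeries.coeff_succ_X_mul, hs, hs,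
        PowerSeries.coeff_C_mul, symbolSeries, PowerSeries.coeff_mk]
      rw [neg_mul] at h
      rw [← h]
      congr 3
      push_cast
      ring

end Dressing

end KP

end

noncomputable section

namespace KP

/-! ### Differential Fay and trisecant identities for `τ` -/

open PowerSeries (C X)

variable {A : Type*} [CommRing A] [Algebra ℚ A] [MultiTimeRing A] {W V : PDO A}

/-- The differential Fay identity for the shifts `t - [X]`, `t - [Y]`. -/
theorem differential_fay (hW : IsDressing W V) {τ : Aˣ}
    (h : symbolSeries W = psShift (-1) (τ : A) * C (↑τ⁻¹ : A)) :
    (C X - X : PowerSeries (PowerSeries A)) *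
        (C (C (τ : A)) * psShift (-1) (psShift (-1) (τ : A)) -
          psShift (-1) (C (τ : A)) * C (psShift (-1) (τ : A))) =
      C X * X * (flow 1 (psShift (-1) (C (τ : A))) * C (psShift (-1) (τ : A)) -
        psShift (-1) (C (τ : A)) * flow 1 (C (psShift (-1) (τ : A)))) := by
  have h0 := hW.psShift_symbolSeries
  set w := symbolSeries W with hw
  set w₁ := W.coeff (-1) with hw₁
  have hg : psShift (-1) (τ : A) = w * C (τ : A) := by
    rw [h, mul_assoc, ← map_mul, Units.inv_mul, map_one, mul_one]
  -- First order in `X` of `τ(t - [X]) = w τ`: this is `w₁ = -∂ₓ log τ`.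
  have h1 : w₁ * (τ : A) = -flow 1 (τ : A) := by
    have := congrArg (PowerSeries.coeff 1) hg
    rw [coeff_psShift, schurOp_one, PowerSeries.coeff_mul_C, hw, symbolSeries,
      PowerSeries.coeff_mk, neg_smul, one_smul] at this
    exact this.symm
  have hF : psShift (-1) (psShift (-1) (τ : A)) = psShift (-1) w * psShift (-1) (C (τ : A)) := by
    rw [hg, map_mul]
  have hG' : (C (psShift (-1) (τ : A)) : PowerSeries (PowerSeries A)) = C w * C (C (τ : A)) := by
    rw [hg, map_mul]
  have hdG' : flow 1 (C (psShift (-1) (τ : A)) : PowerSeries (PowerSeries A)) =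
      C (flow 1 w) * C (C (τ : A)) + C w * flow 1 (C (C (τ : A))) := by
    rw [hG', Derivation.leibniz, flow_C 1 w]
    simp only [smul_eq_mul]
    ring
  have e1 : psShift (-1) (C w₁) * psShift (-1) (C (τ : A)) =
      -flow 1 (psShift (-1) (C (τ : A))) := by
    rw [← map_mul, ← map_mul, h1, ← isFlowHom_psShift, flow_C, map_neg, map_neg]
  have e2 : (C (C w₁) * C (C (τ : A)) : PowerSeries (PowerSeries A)) =
      -flow 1 (C (C (τ : A))) := by
    rw [flow_C, flow_C, ← map_mul, ← map_mul, h1, map_neg, map_neg]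
  rw [hdG', hG', hF]
  set T := (C (C (τ : A)) : PowerSeries (PowerSeries A))
  set G := psShift (-1) (C (τ : A))
  linear_combination T * G * h0 - C X * X * C w * T * e1 + C X * X * C w * G * e2

/-- The differential Fay identity for the shifts `t + [X]`, `t - [Y]`. -/
theorem differential_fay_outer (hW : IsDressing W V) {τ : Aˣ}
    (h : symbolSeries W = psShift (-1) (τ : A) * C (↑τ⁻¹ : A)) :
    (C X - X : PowerSeries (PowerSeries A)) *
        (psShift 1 (C (τ : A)) * C (psShift (-1) (τ : A)) -
          C (C (τ : A)) * psShift 1 (psShift (-1) (τ : A))) =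
      C X * X * (flow 1 (C (C (τ : A))) * psShift 1 (psShift (-1) (τ : A)) -
        C (C (τ : A)) * flow 1 (psShift 1 (psShift (-1) (τ : A)))) := by
  -- Substitute `t ↦ t + [Y]` with `Y` the outer variable: shifts by `-[Y]` disappear and unshifted
  -- terms acquire `+[Y]`.
  have h0 := congrArg (selfShift 1) (differential_fay hW h)
  have hX : psShift 1 (X : PowerSeries A) = C X := psShift_of_flow_eq_zero 1 fun n => flow_X n
  simpa only [map_mul, map_sub, selfShift_C, selfShift_X, selfShift_psShift_neg,
    isFlowHom_selfShift 1 1 _, hX] using h0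

/-- The differential Fay identity for the shifts `t - [X]`, `t + [Y]`. -/
theorem differential_fay_inner (hW : IsDressing W V) {τ : Aˣ}
    (h : symbolSeries W = psShift (-1) (τ : A) * C (↑τ⁻¹ : A)) :
    (C X - X : PowerSeries (PowerSeries A)) *
        (C (psShift 1 (τ : A)) * psShift (-1) (C (τ : A)) -
          psShift (-1) (psShift 1 (τ : A)) * C (C (τ : A))) =
      C X * X * (flow 1 (psShift (-1) (psShift 1 (τ : A))) * C (C (τ : A)) -
        psShift (-1) (psShift 1 (τ : A)) * flow 1 (C (C (τ : A)))) := by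
  -- The same with the inner variable: `t ↦ t + [X]`.
  have h0 := congrArg (PowerSeries.map (selfShift 1)) (differential_fay hW h)
  simpa only [map_mul, map_sub, PowerSeries.map_C, PowerSeries.map_X, selfShift_C, selfShift_X,
    selfShift_psShift_neg, (isFlowHom_selfShift 1).psMap 1 _,
    (isFlowHom_selfShift 1).map_psShift] using h0

/-- Fay's trisecant identity for the shifts `t - [X₁]`, `t + [X₂]`, `t - [X₃]`, where the variables
`X₁`, `X₂`, `X₃` are adjoined in this order. -/
theorem fay (hW : IsDressing W V) {τ : Aˣ}
    (h : symbolSeries W = psShift (-1) (τ : A) * C (↑τ⁻¹ : A)) :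
    (C X * (C (C X) - X) : PowerSeries (PowerSeries (PowerSeries A))) * C (C (C (τ : A))) *
          psShift (-1) (psShift 1 (psShift (-1) (τ : A))) -
        C (C X) * (C X - X) * psShift (-1) (C (C (τ : A))) *
          C (psShift 1 (psShift (-1) (τ : A))) =
      X * (C (C X) - C X) * C (C (psShift (-1) (τ : A))) * psShift (-1) (psShift 1 (C (τ : A))) := by
  have hX : psShift 1 (X : PowerSeries A) = C X := psShift_of_flow_eq_zero 1 fun n => flow_X n
  -- The three instances involve the `x`-derivatives of the logarithms of `τ(t + [X₂] - [X₃]) / τ(t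
  -- + [X₂] - [X₁])`, of `τ(t) / τ(t + [X₂] - [X₁])` and of `τ(t + [X₂] - [X₃]) / τ(t)`. The first
  -- ratio is the product of the other two, so the derivatives cancel.
  have h1 := congrArg (PowerSeries.map (psShift 1)) (differential_fay hW h)
  simp only [map_mul, map_sub, PowerSeries.map_C, PowerSeries.map_X, hX,
    (isFlowHom_psShift 1).psMap 1 _, (isFlowHom_psShift 1).map_psShift] at h1
  have h2 := congrArg C (differential_fay_outer hW h)
  simp only [map_mul, map_sub, isFlowHom_C 1 _] at h2
  have h3 := congrArg (PowerSeries.map (PowerSeries.map C)) (differential_fay_inner hW h)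
  simp only [map_mul, map_sub, PowerSeries.map_C, PowerSeries.map_X,
    isFlowHom_C.psMap.psMap 1 _, isFlowHom_C.psMap.map_psShift, isFlowHom_C.map_psShift] at h3
  -- The elimination yields the identity multiplied by `τ(t + [X₂])`, which is invertible along with
  -- `τ`.
  have hu : IsUnit (C (psShift 1 (C (τ : A))) : PowerSeries (PowerSeries (PowerSeries A))) :=
    (((τ.isUnit.map C).map (psShift 1)).map C)
  refine hu.mul_left_cancel ?_
  linear_combination C (C (C (τ : A))) * C X * h1 -
    C (C X) * C (psShift 1 (psShift (-1) (τ : A))) * h3 -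
    X * psShift (-1) (psShift 1 (C (τ : A))) * h2

end KP

end

noncomputable section

namespace KP

open Finset

/-! ### Power series and exponentials inside the wave rings -/

namespace WaveRing

section Basic

variable {B : Type*} [CommRing B]

/-- Power series in the inverse spectral parameter, inside `WaveRing B`. -/
def ofPS : PowerSeries B →+* WaveRing B :=
  (AddMonoidAlgebra.singleZeroRingHom : LaurentSeries B →+* AddMonoidAlgebra (LaurentSeries B) ℤ).comp
    (HahnSeries.ofPowerSeries ℤ B)

theorem ofPS_apply (F : PowerSeries B) : ofPS F = term 0 (HahnSeries.ofPowerSeries ℤ B F) := rfl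

theorem ofPS_C (b : B) : ofPS (PowerSeries.C b) = const b := by
  rw [ofPS_apply, HahnSeries.ofPowerSeries_C]
  rfl

theorem ofPS_X : ofPS (PowerSeries.X : PowerSeries B) = spec (-1) := by
  rw [ofPS_apply, HahnSeries.ofPowerSeries_X, spec, zpow, neg_neg]

theorem ofPowerSeries_coeff_neg (F : PowerSeries B) {i : ℤ} (hi : i < 0) :
    (HahnSeries.ofPowerSeries ℤ B F).coeff i = 0 := by
  rw [HahnSeries.ofPowerSeries_apply]
  refine HahnSeries.embDomain_of_notMem_range ?_
  rintro ⟨n, rfl⟩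
  exact absurd hi (by simp)

theorem spec_mul_spec (k l : ℤ) : (spec k * spec l : WaveRing B) = spec (k + l) := by
  rw [spec, spec, spec, term_mul_term, zpow, zpow, zpow, HahnSeries.single_mul_single, mul_one,
    add_zero, neg_add]

theorem spec_zero : (spec 0 : WaveRing B) = 1 := by
  rw [spec, zpow, neg_zero]
  rfl

theorem spec_mul_spec_neg (k : ℤ) : (spec k * spec (-k) : WaveRing B) = 1 := by
  rw [spec_mul_spec, add_neg_cancel, spec_zero]

theorem expXi_mul_expXi (k l : ℤ) : (expXi k * expXi l : WaveRing B) = expXi (k + l) := by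
  rw [expXi, expXi, expXi, term_mul_term, one_mul]

theorem expXi_zero : (expXi 0 : WaveRing B) = 1 := rfl

theorem coeff_zpow_mul (k : ℤ) (f : LaurentSeries B) (i : ℤ) :
    (zpow k * f).coeff i = f.coeff (i + k) := by
  rw [zpow, HahnSeries.coeff_single_mul, one_mul, sub_neg_eq_add]

theorem part_term_self (k : ℤ) (f : LaurentSeries B) : (term k f).part k = f := by
  rw [part_term, if_pos rfl]

theorem term_add (k : ℤ) (f g : LaurentSeries B) : term k (f + g) = term k f + term k g :=
  AddMonoidAlgebra.single_add k f g

theorem term_neg (k : ℤ) (f : LaurentSeries B) : term k (-f) = -term k f :=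
  AddMonoidAlgebra.single_neg k f

theorem ofPS_mul_expXi (F : PowerSeries B) (k : ℤ) :
    ofPS F * expXi k = term k (HahnSeries.ofPowerSeries ℤ B F) := by
  rw [ofPS_apply, expXi, term_mul_term, zero_add, mul_one]

/-- The series `F(X)` with coefficients transported along `φ`, at `X = z⁻¹`. -/
def liftPS {B' : Type*} [CommRing B'] (φ : B →+* B') : PowerSeries B →+* WaveRing B' :=
  ofPS.comp (PowerSeries.map φ)

variable {B' : Type*} [CommRing B'] (φ : B →+* B')

theorem liftPS_C (b : B) : liftPS φ (PowerSeries.C b) = const (φ b) := by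
  rw [liftPS, RingHom.comp_apply, PowerSeries.map_C, ofPS_C]

theorem liftPS_X : liftPS φ PowerSeries.X = spec (-1) := by
  rw [liftPS, RingHom.comp_apply, PowerSeries.map_X, ofPS_X]

end Basic

variable {B : Type*} [CommRing B] [Algebra ℚ B] [MultiTimeRing B]

theorem flow_term (n : ℕ+) (k : ℤ) (f : LaurentSeries B) :
    flow n (term k f) = term k (laurentDerivation (flow n) f + k • (zpow (n : ℤ) * f)) :=
  flowLinear_term (flow n) n k f

theorem isFlowHom_ofPS : IsFlowHom (ofPS (B := B)) := by
  intro n F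
  rw [ofPS_apply, ofPS_apply, flow_term, zero_smul, add_zero]
  congr 1
  ext i
  rw [laurentDerivation_coeff]
  rcases lt_or_ge i 0 with hi | hi
  · rw [ofPowerSeries_coeff_neg _ hi, ofPowerSeries_coeff_neg _ hi, map_zero]
  · obtain ⟨m, rfl⟩ := Int.eq_ofNat_of_zero_le hi
    rw [HahnSeries.ofPowerSeries_apply_coeff, HahnSeries.ofPowerSeries_apply_coeff, coeff_flow]

theorem isFlowHom_const : IsFlowHom (const (B := B)) := by
  intro n b
  rw [← ofPS_C, ← ofPS_C, ← isFlowHom_ofPS, flow_C]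

theorem flow_spec (n : ℕ+) (k : ℤ) : flow n (spec k : WaveRing B) = 0 := by
  rw [spec, flow_term, zero_smul, add_zero]
  ext l i
  rw [part_term]
  split_ifs
  · rw [laurentDerivation_coeff, zpow, HahnSeries.coeff_single]
    split_ifs
    · exact Derivation.map_one_eq_zero _
    · exact map_zero _
  · rfl

theorem flow_expXi (n : ℕ+) (k : ℤ) :
    flow n (expXi k : WaveRing B) = k • (spec n * expXi k) := by
  have h1 : laurentDerivation (flow n) (1 : LaurentSeries B) = 0 :=
    Derivation.map_one_eq_zero _
  rw [expXi, flow_term, h1, zero_add, spec, term_mul_term, zero_add]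
  ext l
  have : (k • term k (zpow (n : ℤ) * 1 : LaurentSeries B)).part l =
      k • (term k (zpow (n : ℤ) * 1)).part l := rfl
  rw [this, part_term, part_term]
  split_ifs <;> simp

theorem shift_eq_ofPS (ε : ℚ) (f : B) : shift ε f = ofPS (psShift ε f) := rfl

section Lift

variable {B' : Type*} [CommRing B'] [Algebra ℚ B'] [MultiTimeRing B'] {φ : B →+* B'}

theorem liftPS_psShift (hφ : IsFlowHom φ) (ε : ℚ) (b : B) :
    liftPS φ (psShift ε b) = shift ε (φ b) := by
  rw [liftPS, RingHom.comp_apply, hφ.map_psShift, shift_eq_ofPS]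

theorem isFlowHom_liftPS (hφ : IsFlowHom φ) : IsFlowHom (liftPS φ) :=
  isFlowHom_ofPS.comp hφ.psMap

end Lift

/-- `e^{kξ(t + ε[X], z)} = e^{kξ(t, z)} (1 - z X)` for `ε k = -1`. -/
theorem psShift_expXi {ε : ℚ} {k : ℤ} (h : ε * k = -1) :
    psShift ε (expXi k : WaveRing B) =
      PowerSeries.C (expXi k) * (1 - PowerSeries.C (spec 1) * PowerSeries.X) := by
  set e : WaveRing B := expXi k with he
  have hflow : ∀ n : ℕ, ∀ hn : 0 < n, flowNat n e = k • (spec n * e) := by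
    intro n hn
    rw [flowNat, dif_pos hn, he, flow_expXi]
    rfl
  have hspec : ∀ n : ℕ, ∀ b : WaveRing B, flowNat n (spec 1 * b) = spec 1 * flowNat n b := by
    intro n b
    unfold flowNat
    split_ifs with hn
    · rw [Derivation.leibniz, flow_spec, smul_zero, add_zero, smul_eq_mul]
    · simp
  have hc0 : PowerSeries.coeff 0 (PowerSeries.C e * (1 - PowerSeries.C (spec 1) * PowerSeries.X)) =
      e := by simp
  have hc1 : PowerSeries.coeff 1 (PowerSeries.C e * (1 - PowerSeries.C (spec 1) * PowerSeries.X)) =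
      -(spec 1 * e) := by
    rw [PowerSeries.coeff_C_mul, map_sub, PowerSeries.coeff_C_mul, PowerSeries.coeff_one,
      PowerSeries.coeff_one_X]
    simp only [one_ne_zero, if_false]
    ring
  have hc2 : ∀ n, PowerSeries.coeff (n + 2)
      (PowerSeries.C e * (1 - PowerSeries.C (spec 1) * PowerSeries.X)) = 0 := by
    intro n
    rw [PowerSeries.coeff_C_mul, map_sub, PowerSeries.coeff_C_mul, PowerSeries.coeff_one,
      PowerSeries.coeff_X]
    simp
  refine IsShiftSeries.eq_psShift (fun n => ?_) hc0
  rw [coeff_seqDerivation]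
  rcases n with _ | _ | n
  · rw [Finset.Nat.antidiagonal_zero, sum_singleton, hc0]
    simp [flowNat]
  · rw [Nat.sum_antidiagonal_succ', zero_add, Finset.Nat.antidiagonal_zero, sum_singleton, hc0,
      zero_add, hc1, hflow 1 one_pos, ← Int.cast_smul_eq_zsmul ℚ, smul_add, smul_smul, h]
    simp [flowNat]
  · rw [Nat.sum_antidiagonal_succ', Nat.sum_antidiagonal_succ', sum_eq_zero, hc0]
    · simp only [zero_add, hc1, hc2, map_neg, hspec]
      -- Only the terms from `X⁰` and `X¹` survive, and they contribute opposite multiples of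
      -- `z^{n+2} e`.
      rw [hflow _ (by omega), hflow _ (by omega), mul_smul_comm, ← mul_assoc, spec_mul_spec]
      push_cast
      rw [add_comm 1 ((n : ℤ) + 1), add_zero, add_neg_cancel, smul_zero, smul_zero]
    · intro p _
      rw [hc2, map_zero]

/-- The equation `(∂ₓ + z) s = 0` determines each coefficient from the preceding one, and those
below the order of `s` are zero. This fixes the additive constant of the potential. -/
theorem eq_zero_of_flow_term {s : LaurentSeries B} (h : flow 1 (term 1 s) = 0) : s = 0 := by
  rw [flow_term, one_smul] at h
  have h' : laurentDerivation (flow 1) s + zpow 1 * s = 0 := by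
    have := congrArg (fun p => part p 1) h
    simp only [part_term_self] at this
    exact this
  have hc : ∀ i, s.coeff (i + 1) = -flow 1 (s.coeff i) := by
    intro i
    have := congrArg (fun f => HahnSeries.coeff f i) h'
    simp only [HahnSeries.coeff_add, laurentDerivation_coeff, coeff_zpow_mul] at this
    exact eq_neg_of_add_eq_zero_right this
  ext i
  have key : ∀ n : ℕ, ∀ i, i < s.order + n → s.coeff i = 0 := by
    intro n
    induction n with
    | zero => exact fun i hi => HahnSeries.coeff_eq_zero_of_lt_order (by simpa using hi)
    | succ n ih =>
      intro i hi
      have := hc (i - 1)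
      rwa [ih (i - 1) (by push_cast at hi; omega), map_zero, neg_zero, sub_add_cancel] at this
  exact key (i - s.order + 1).toNat i (by omega)

end WaveRing

/-! ### Operators acting on exponentials -/

namespace PDO

open WaveRing

section Basic

variable {B : Type*} [CommRing B]

theorem applyExp_eq_iff {P : PDO B} {f : LaurentSeries B} :
    P.applyExp = term 1 f ↔ ∀ i, P.coeff (-i) = f.coeff i := by
  constructor
  · intro h i
    have := congrArg (fun p => (part p 1).coeff i) h
    simpa [applyExp, part_term_self] using this
  · intro h
    rw [applyExp]
    congr 1
    ext i
    simpa using h i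

theorem applyExpNeg_eq_iff {P : PDO B} {f : LaurentSeries B} :
    P.applyExpNeg = term (-1) f ↔ ∀ i, ((Int.negOnePow i : ℤ) : B) * P.coeff (-i) = f.coeff i := by
  constructor
  · intro h i
    have := congrArg (fun p => (part p (-1)).coeff i) h
    simpa [applyExpNeg, part_term_self] using this
  · intro h
    rw [applyExpNeg]
    congr 1
    ext i
    simpa using h i

theorem exists_applyExp (P : PDO B) : ∃ f, P.applyExp = term 1 f := ⟨_, rfl⟩

theorem applyExp_add (P Q : PDO B) : (P + Q).applyExp = P.applyExp + Q.applyExp := by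
  obtain ⟨f, hf⟩ := exists_applyExp P
  obtain ⟨g, hg⟩ := exists_applyExp Q
  rw [hf, hg, ← term_add, applyExp_eq_iff]
  intro i
  rw [coeff_add, applyExp_eq_iff.1 hf, applyExp_eq_iff.1 hg, HahnSeries.coeff_add]

theorem map_ofPowerSeries_coeff {B' : Type*} [CommRing B'] (φ : B →+* B') (F : PowerSeries B)
    (i : ℤ) : φ ((HahnSeries.ofPowerSeries ℤ B F).coeff i) =
      (HahnSeries.ofPowerSeries ℤ B' (PowerSeries.map φ F)).coeff i := by
  rcases lt_or_ge i 0 with hi | hi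
  · rw [ofPowerSeries_coeff_neg _ hi, ofPowerSeries_coeff_neg _ hi, map_zero]
  · obtain ⟨m, rfl⟩ := Int.eq_ofNat_of_zero_le hi
    rw [HahnSeries.ofPowerSeries_apply_coeff, HahnSeries.ofPowerSeries_apply_coeff,
      PowerSeries.coeff_map]

theorem applyExp_map {B' : Type*} [CommRing B'] (φ : B →+* B') {P : PDO B} {F : PowerSeries B}
    (h : P.applyExp = ofPS F * expXi 1) :
    (P.map φ).applyExp = ofPS (PowerSeries.map φ F) * expXi 1 := by
  rw [ofPS_mul_expXi, applyExp_eq_iff] at h ⊢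
  intro i
  rw [coeff_map, h, map_ofPowerSeries_coeff]

theorem applyExpNeg_map {B' : Type*} [CommRing B'] (φ : B →+* B') {P : PDO B} {F : PowerSeries B}
    (h : P.applyExpNeg = ofPS F * expXi (-1)) :
    (P.map φ).applyExpNeg = ofPS (PowerSeries.map φ F) * expXi (-1) := by
  rw [ofPS_mul_expXi, applyExpNeg_eq_iff] at h ⊢
  intro i
  rw [coeff_map, ← map_ofPowerSeries_coeff, ← h, map_mul, map_intCast]

end Basic

variable {B : Type*} [CommRing B] [Algebra ℚ B] [MultiTimeRing B]

theorem flow_applyExp (n : ℕ+) (P : PDO B) : flow n P.applyExp = (nabla n P).applyExp := by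
  obtain ⟨f, hf⟩ := exists_applyExp P
  rw [hf, flow_term, eq_comm, applyExp_eq_iff]
  intro i
  rw [one_smul, nabla, coeff_add, coeff_deriv, coeff_mul_D, HahnSeries.coeff_add,
    laurentDerivation_coeff, coeff_zpow_mul, ← applyExp_eq_iff.1 hf, ← applyExp_eq_iff.1 hf, neg_add']

theorem const_mul_applyExp (b : B) (P : PDO B) :
    const b * P.applyExp = (ofFun b * P).applyExp := by
  obtain ⟨f, hf⟩ := exists_applyExp P
  rw [hf, ← ofPS_C, ofPS_apply, HahnSeries.ofPowerSeries_C, term_mul_term, zero_add, eq_comm,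
    applyExp_eq_iff]
  intro i
  rw [coeff_ofFun_mul, applyExp_eq_iff.1 hf, HahnSeries.C_mul_eq_smul, HahnSeries.coeff_smul,
    smul_eq_mul]

theorem map_adjoint {B' : Type*} [CommRing B'] [Algebra ℚ B'] [MultiTimeRing B'] {φ : B →+* B'}
    (hφ : IsFlowHom φ) (P : PDO B) : P.adjoint.map φ = (P.map φ).adjoint := by
  ext m
  obtain ⟨N, hN⟩ := P.bounded
  refine (φ.toAddMonoidHom.map_finsum ?_).trans (finsum_congr fun j => ?_)
  · refine (Set.finite_Iic (N - m).toNat).subset fun j hj => ?_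
    by_contra h
    rw [Set.mem_Iic] at h
    exact hj (by simp [hN (m + j) (by omega)])
  · change φ _ = _
    rw [map_zsmul, map_iterate_flow hφ, coeff_map]

end PDO

end KP

end

noncomputable section

namespace KP

open Finset

/-! ### Adjoint action on `e^{-ξ}` through residues -/

namespace PDO

open WaveRing

section Additive

variable {B : Type*} [CommRing B]

theorem IsDiff.res_eq_zero {P : PDO B} (hP : P.IsDiff) : P.res = 0 := hP _ (by omega)

theorem res_add (P Q : PDO B) : (P + Q).res = P.res + Q.res := rfl

end Additive

variable {B : Type*} [CommRing B] [Algebra ℚ B] [MultiTimeRing B]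

/-- A differential operator is a finite sum of operators `a Dᵏ` with `k ≥ 0`. -/
theorem IsDiff.induction_on {motive : PDO B → Prop} {P : PDO B} (hP : P.IsDiff) (zero : motive 0)
    (add : ∀ P Q, motive P → motive Q → motive (P + Q))
    (ofFun_mul_D : ∀ (a : B) (k : ℕ), motive (ofFun a * D k)) : motive P := by
  obtain ⟨N, hN⟩ := P.bounded
  have h : P = ∑ k ∈ range (N.toNat + 1), ofFun (P.coeff k) * D k := by
    ext l
    rw [coeff_sum]
    simp only [coeff_mul_D, coeff_ofFun, sub_eq_zero]
    rcases lt_or_ge l 0 with hl | hl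
    · rw [hP l hl, sum_eq_zero]
      intro k _
      rw [if_neg (by omega)]
    · obtain ⟨l, rfl⟩ := Int.eq_ofNat_of_zero_le hl
      simp only [Nat.cast_inj, sum_ite_eq, mem_range]
      split_ifs with h
      · rfl
      · exact hN _ (by omega)
  rw [h]
  exact sum_induction _ motive add zero fun k _ => ofFun_mul_D _ _

theorem deriv_ofFun (n : ℕ+) (a : B) : (ofFun a).deriv n = ofFun (flow n a) := by
  ext k
  simp only [coeff_deriv, coeff_ofFun]
  split_ifs <;> simp

theorem res_D_neg_one_mul_ofFun (a : B) : (D (-1) * ofFun a).res = a := by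
  rw [res_mul_ofFun, res, coeff_D, if_pos rfl, one_mul]

/-- In negative order the hypothesis reads `X_{k-1} = -∂X_k`, so the residue controls the whole
negative part. -/
theorem isDiff_of_isDiff_D_one_mul {X : PDO B} (h : (D 1 * X).IsDiff) (h0 : X.res = 0) :
    X.IsDiff := by
  have key : ∀ i : ℕ, X.coeff (-1 - i) = 0 := by
    intro i
    induction i with
    | zero => simpa [res] using h0
    | succ i ih =>
      have := h (-1 - i) (by omega)
      rw [D_one_mul, coeff_add, coeff_mulD, coeff_deriv, ih, map_zero, add_zero] at this
      rw [← this]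
      congr 1
      push_cast
      ring
  intro k hk
  obtain ⟨i, hi⟩ := Int.eq_ofNat_of_zero_le (show 0 ≤ -1 - k by omega)
  rw [show k = -1 - i by omega]
  exact key i

theorem coeff_D_neg_one_mul_ofFun (a : B) {k : ℤ} (hk : 0 ≤ k) :
    (D (-1) * ofFun a).coeff k = 0 := by
  refine (coeff_mul_eq_sum (P := D (-1)) (Q := ofFun a) (N := -1) (M := 0) (c := k) (J := 0)
    (fun l hl => ?_) (fun l hl => ?_) (by omega) (by omega)).trans (by simp)
  · rw [coeff_D, if_neg (by omega)]
  · rw [coeff_ofFun, if_neg (by omega)]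

section Transform

theorem bddBelow_res (X : PDO B) :
    BddBelow (Function.support fun i : ℤ => (D (i - 1) * X).res) := by
  obtain ⟨N, hN⟩ := X.bounded
  refine ⟨-N, fun i hi => ?_⟩
  by_contra hlt
  refine hi ?_
  refine (coeff_mul_eq_sum (P := D (i - 1)) (Q := X) (N := i - 1) (M := N) (c := -1 - N) (J := 0)
    (fun l hl => ?_) hN (by omega) (by omega)).trans (by simp)
  rw [coeff_D, if_neg (by omega)]

/-- The action `X*(e^{-ξ})` of the adjoint, with coefficients expressed through residues. -/
def adjExp (X : PDO B) : WaveRing B := term (-1) (HahnSeries.ofSuppBddBelow _ X.bddBelow_res)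

theorem adjExp_eq_iff {X : PDO B} {f : LaurentSeries B} :
    X.adjExp = term (-1) f ↔ ∀ i, (D (i - 1) * X).res = f.coeff i := by
  constructor
  · intro h i
    have := congrArg (fun p => (part p (-1)).coeff i) h
    simpa [adjExp, part_term_self] using this
  · intro h
    rw [adjExp]
    congr 1
    ext i
    simpa using h i

theorem exists_adjExp (X : PDO B) : ∃ f, X.adjExp = term (-1) f := ⟨_, rfl⟩

theorem applyExpNeg_adjoint (X : PDO B) : X.adjoint.applyExpNeg = X.adjExp := by
  obtain ⟨f, hf⟩ := exists_adjExp X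
  rw [hf, applyExpNeg_eq_iff]
  intro i
  rw [← adjExp_eq_iff.1 hf]
  obtain ⟨N, hN⟩ := X.bounded
  have hD : (D (i - 1) * X).res = ∑ j ∈ range ((N + i).toNat + 1),
      Ring.choose (i - 1) j • (1 * (flow 1)^[j] (X.coeff (-1 + j - (i - 1)))) := by
    rw [res, D]
    exact coeff_mono_mul 1 hN (by omega)
  have hA : X.adjoint.coeff (-i) = ∑ j ∈ range ((N + i).toNat + 1),
      ((Int.negOnePow (-i + j) : ℤ) * Ring.choose (-i + j) j) •
        (flow 1)^[j] (X.coeff (-i + j)) := by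
    refine finsum_eq_sum_of_support_subset _ fun j hj => ?_
    simp only [SetLike.mem_coe, mem_range]
    by_contra h
    exact hj (by simp [hN (-i + j) (by omega)])
  rw [hD, hA, mul_sum]
  refine sum_congr rfl fun j _ => ?_
  -- The two expansions match by the reflection `choose (-(1 - i)) j = (-1)ʲ choose (j - i) j`,
  -- whose sign is the one produced by the adjoint and `(-z)ᵏ`.
  rw [one_mul, show (-1 : ℤ) + j - (i - 1) = -i + j by ring, show i - 1 = -(1 - i) by ring,
    Ring.choose_neg, show (1 : ℤ) - i + j - 1 = -i + j by ring, ← smul_eq_mul,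
    Int.cast_smul_eq_zsmul, smul_smul, ← mul_assoc, ← Units.val_mul, ← Int.negOnePow_add,
    add_neg_cancel_left]
  rfl

theorem adjExp_add (X Y : PDO B) : (X + Y).adjExp = X.adjExp + Y.adjExp := by
  obtain ⟨f, hf⟩ := exists_adjExp X
  obtain ⟨g, hg⟩ := exists_adjExp Y
  rw [hf, hg, ← term_add, adjExp_eq_iff]
  intro i
  rw [mul_add, res_add, adjExp_eq_iff.1 hf, adjExp_eq_iff.1 hg, HahnSeries.coeff_add]

theorem adjExp_zero : (0 : PDO B).adjExp = 0 := by
  have := adjExp_add (0 : PDO B) 0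
  rwa [add_zero, left_eq_add] at this

theorem adjExp_neg (X : PDO B) : (-X).adjExp = -X.adjExp := by
  rw [eq_neg_iff_add_eq_zero, ← adjExp_add, neg_add_cancel, adjExp_zero]

/-- The exponential contributes the factor `-zⁿ`, and in the residue description multiplication by
`zⁿ` is a left factor `Dⁿ`. -/
theorem flow_adjExp (n : ℕ+) (X : PDO B) : flow n X.adjExp = (X.deriv n - D n * X).adjExp := by
  obtain ⟨f, hf⟩ := exists_adjExp X
  rw [hf, flow_term, eq_comm, adjExp_eq_iff]
  intro i
  rw [neg_one_smul, HahnSeries.coeff_add, HahnSeries.coeff_neg, laurentDerivation_coeff,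
    coeff_zpow_mul, ← adjExp_eq_iff.1 hf, ← adjExp_eq_iff.1 hf, mul_sub, ← mul_assoc, D_mul_D,
    ← sub_eq_add_neg, sub_add_eq_add_sub]
  have h : (D (i - 1) * X).deriv n = D (i - 1) * X.deriv n := by
    rw [deriv_mul, deriv_D, zero_mul, zero_add]
  rw [res, coeff_sub, ← h]
  rfl

theorem adjExp_mul_ofFun (X : PDO B) (a : B) : (X * ofFun a).adjExp = X.adjExp * const a := by
  obtain ⟨f, hf⟩ := exists_adjExp X
  rw [hf, mul_comm, ← ofPS_C, ofPS_apply, HahnSeries.ofPowerSeries_C, term_mul_term, zero_add,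
    adjExp_eq_iff]
  intro i
  rw [← mul_assoc, res_mul_ofFun, adjExp_eq_iff.1 hf, HahnSeries.C_mul_eq_smul,
    HahnSeries.coeff_smul, smul_eq_mul, mul_comm]

theorem adjExp_mul_D_one (X : PDO B) : (X * D 1).adjExp = -flow 1 X.adjExp := by
  rw [flow_adjExp, ← adjExp_neg, neg_sub]
  obtain ⟨f, hf⟩ := exists_adjExp (D ((1 : ℕ+) : ℤ) * X - X.deriv 1)
  rw [hf, adjExp_eq_iff]
  intro i
  rw [← adjExp_eq_iff.1 hf]
  have h : (D (i - 1) * X).deriv 1 = D (i - 1) * X.deriv 1 := by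
    rw [deriv_mul, deriv_D, zero_mul, zero_add]
  rw [mul_sub, ← h, ← mul_assoc, ← mul_assoc, D_mul_D, res, res, coeff_sub]
  have h2 := res_D_one_mul (D (i - 1) * X)
  rw [← mul_assoc, D_mul_D] at h2
  rw [PNat.one_coe, Nat.cast_one, add_comm (i - 1)]
  exact eq_sub_of_add_eq h2.symm

/-- `(XP)*(e^{-ξ}) = P*(X*(e^{-ξ}))` for differential operators `P`, where `P*(f)` is the residue
of `D⁻¹ f P`. -/
theorem adjExp_mul_isDiff (X : PDO B) {P : PDO B} (hP : P.IsDiff) :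
    (X * P).adjExp = (D (-1) * (ofFun X.adjExp * P.map const)).res := by
  refine IsDiff.induction_on (motive := fun P => (X * P).adjExp =
    (D (-1) * (ofFun X.adjExp * P.map const)).res) hP ?_ ?_ ?_
  · rw [mul_zero, adjExp_zero]
    have : (0 : PDO B).map (const (B := B)) = 0 := by ext1; funext k; exact map_zero _
    rw [this, mul_zero, mul_zero]
    rfl
  · intro P Q hP hQ
    have : (P + Q).map (const (B := B)) = P.map const + Q.map const := by
      ext1; funext k; exact map_add _ _ _
    rw [mul_add, adjExp_add, hP, hQ, this, mul_add, mul_add, res_add]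
  · intro a k
    rw [map_mul' isFlowHom_const, map_ofFun, map_D]
    induction k with
    | zero =>
      rw [Nat.cast_zero, D_zero, D_zero, mul_one, mul_one, adjExp_mul_ofFun, ofFun_mul_ofFun,
        res_D_neg_one_mul_ofFun]
    | succ k ih =>
      -- Integration by parts: cancelling `D D⁻¹` leaves a differential operator, with zero residue,
      -- so a right factor `D` acts as `-∂ₓ` on the residue.
      have h := res_D_one_mul (D (-1) * (ofFun X.adjExp * (ofFun (const a) * D k)))
      rw [D_one_mul_D_neg_one_mul, IsDiff.res_eq_zero
        ((isDiff_ofFun _).mul ((isDiff_ofFun _).mul (isDiff_D (by omega)))), ← ih] at h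
      have hD : ∀ (C : Type _) [CommRing C] [Algebra ℚ C] [MultiTimeRing C],
          (D ((k + 1 : ℕ) : ℤ) : PDO C) = D k * D 1 := fun C _ _ _ => by
        rw [D_mul_D]; push_cast; rfl
      rw [hD, hD, ← mul_assoc, ← mul_assoc, adjExp_mul_D_one, mul_assoc X]
      simp only [mul_assoc] at h ⊢
      exact (eq_neg_of_add_eq_zero_left h.symm).symm

end Transform

/-- The function `P(f)` for a differential operator `P`. -/
theorem coeff_zero_mul_ofFun_applyExp (X Q : PDO B) :
    (X.map const * ofFun Q.applyExp).coeff 0 = (X.posPart * Q).applyExp := by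
  have h : (X.map (const (B := B)) * ofFun Q.applyExp).coeff 0 =
      (X.posPart.map const * ofFun Q.applyExp).coeff 0 := by
    refine coeff_mul_congr (M := 0) (fun k hk => ?_) fun k hk => ?_
    · rw [coeff_ofFun, if_neg (by omega)]
    · rw [coeff_map, coeff_map, coeff_posPart, if_pos (by omega)]
  rw [h]
  refine IsDiff.induction_on (motive := fun P => (P.map (const (B := B)) *
    ofFun Q.applyExp).coeff 0 = (P * Q).applyExp) (isDiff_posPart X) ?_ ?_ ?_
  · have h1 : (0 : PDO B).map (const (B := B)) = 0 := by ext1; funext k; exact map_zero _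
    have h2 : (0 : PDO B).applyExp = 0 := by
      have := applyExp_add (0 : PDO B) 0
      rwa [add_zero, left_eq_add] at this
    rw [h1, zero_mul, zero_mul, h2]
    rfl
  · intro P P' hP hP'
    have : (P + P').map (const (B := B)) = P.map const + P'.map const := by
      ext1; funext k; exact map_add _ _ _
    rw [this, add_mul, add_mul, coeff_add, hP, hP', applyExp_add]
  · intro a k
    rw [map_mul' isFlowHom_const, map_ofFun, map_D, mul_assoc, mul_assoc, coeff_ofFun_mul,
      ← const_mul_applyExp]
    congr 1
    induction k with
    | zero => rw [Nat.cast_zero, D_zero, D_zero, one_mul, one_mul, coeff_ofFun, if_pos rfl]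
    | succ k ih =>
      have hd : (D (k : ℤ) * ofFun Q.applyExp).IsDiff :=
        (isDiff_D (by omega)).mul (isDiff_ofFun _)
      rw [Nat.cast_succ, D_succ_mul, coeff_add, coeff_mulD, coeff_deriv, ih, hd _ (by omega),
        zero_add, flow_applyExp, D_succ_mul', D_one_mul, nabla]
      congr 1
      rw [add_comm]
      congr 1
      ext m
      rw [coeff_mulD, PNat.one_coe, Nat.cast_one, coeff_mul_D]

end PDO

open PDO WaveRing

/-! ### The squared eigenfunction potential as `(D⁻¹ ψ* W)(e^ξ)` -/

section SEP

variable {A : Type*} [CommRing A] [Algebra ℚ A] [MultiTimeRing A] {W V : PDO A}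

theorem laxPow_map {A' : Type*} [CommRing A'] [Algebra ℚ A'] [MultiTimeRing A'] {φ : A →+* A'}
    (hφ : IsFlowHom φ) (W V : PDO A) (n : ℕ+) :
    (laxPow W V n).map φ = laxPow (W.map φ) (V.map φ) n := by
  rw [laxPow, laxPow, PDO.map_mul' hφ, PDO.map_mul' hφ, map_D]

theorem IsDressing.map (hW : IsDressing W V) {A' : Type*} [CommRing A'] [Algebra ℚ A']
    [MultiTimeRing A'] {φ : A →+* A'} (hφ : IsFlowHom φ) :
    IsDressing (W.map φ) (V.map φ) where
  coeff_zero := by rw [coeff_map, hW.coeff_zero, map_one]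
  coeff_pos k hk := by rw [coeff_map, hW.coeff_pos k hk, map_zero]
  mul_inv := by rw [← PDO.map_mul' hφ, hW.mul_inv, map_ofFun, map_one]
  inv_mul := by rw [← PDO.map_mul' hφ, hW.inv_mul, map_ofFun, map_one]
  wilson_sato n k := by
    have h : (laxPow (W.map φ) (V.map φ) n).negPart = (laxPow W V n).negPart.map φ := by
      rw [← laxPow_map hφ]
      ext l
      rw [coeff_map, coeff_negPart, coeff_negPart, coeff_map]
      split_ifs <;> simp
    rw [h, ← PDO.map_mul' hφ, coeff_map, coeff_map, ← hφ, hW.wilson_sato, map_neg]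

/-- Differentiating `V W = 1` gives `∂ₙV = V (L^{n/r})₋`, while `Dⁿ V = V L^{n/r}`. -/
theorem IsDressing.deriv_inv (hW : IsDressing W V) (n : ℕ+) :
    V.deriv n - D n * V = -(V * (laxPow W V n).posPart) := by
  have h1 : V.deriv n * W + V * W.deriv n = 0 := by
    rw [← PDO.deriv_mul, hW.inv_mul, deriv_ofFun, Derivation.map_one_eq_zero]
    ext k
    rw [coeff_ofFun, ite_self]
    rfl
  have h2 : V.deriv n = V * (laxPow W V n).negPart := by
    have h3 : (V.deriv n * W + V * W.deriv n) * V = 0 := by rw [h1, zero_mul]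
    rw [hW.deriv_eq, add_mul, mul_assoc, hW.mul_inv, ← one_def, mul_one, mul_neg, neg_mul,
      mul_assoc, mul_assoc, hW.mul_inv, ← one_def, mul_one, ← sub_eq_add_neg, sub_eq_zero] at h3
    exact h3
  have h4 : D n * V = V * laxPow W V n := by
    rw [laxPow, ← mul_assoc, hW.inv_mul, ← one_def, one_mul]
  rw [h2, h4, ← mul_sub, ← mul_neg]
  congr 1
  rw [sub_eq_iff_eq_add, neg_add_eq_sub, eq_sub_iff_add_eq, add_comm, PDO.posPart_add_negPart]

/-- The adjoint linear problem for the adjoint Baker–Akhiezer function. -/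
theorem IsDressing.flow_adjWaveFun (hW : IsDressing W V) (n : ℕ+) :
    flow n (adjWaveFun V) =
      -(D (-1) * (ofFun (adjWaveFun V) * (laxPow W V n).posPart.map const)).res := by
  rw [adjWaveFun, applyExpNeg_adjoint, flow_adjExp, hW.deriv_inv, adjExp_neg,
    adjExp_mul_isDiff V (isDiff_posPart _)]

/-- The squared eigenfunction potential of `ψ(t,z)` and `ψ*(t,λ)`, in closed form. -/
def sep (W V : PDO A) : WaveRing (WaveRing A) :=
  (D (-1) * (ofFun (adjWaveFun V) * W.map const)).applyExp

/-- For the flow `∂ₓ`, `nabla` is left multiplication by `D`, which cancels `D⁻¹`. -/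
theorem flow_one_sep (W V : PDO A) :
    flow 1 (sep W V) = const (adjWaveFun V) * (W.map const).applyExp := by
  rw [sep, flow_applyExp, const_mul_applyExp]
  congr 1
  set Q := ofFun (adjWaveFun V) * W.map const
  have h : nabla 1 (D (-1) * Q) = D 1 * (D (-1) * Q) := by
    rw [D_one_mul, nabla, add_comm]
    congr 1
    ext m
    rw [coeff_mulD, PNat.one_coe, Nat.cast_one, coeff_mul_D]
  rw [h, D_one_mul_D_neg_one_mul]

/-- The linear problem for `W` turns `∇ₙ(D⁻¹ Ψ W)` into `(D⁻¹ (∂ₙΨ) + D⁻¹ Ψ P) W`. The adjoint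
linear problem makes the bracket differential, hence equal to `(D⁻¹ Ψ P)₊`, and applying this to `ψ`
gives the prescribed residue. -/
theorem isSEP_sep (hW : IsDressing W V) :
    IsSEP (fun n => (laxPow W V n).map (const.comp const)) (W.map const).applyExp
      (const (adjWaveFun V)) (sep W V) := by
  intro n
  set Ψ := adjWaveFun V with hΨ
  set P := (laxPow W V n).posPart.map (const (B := A)) with hP
  set Z := D (-1) * (ofFun Ψ * P) with hZ
  set N := D (-1) * ofFun (flow n Ψ) with hN
  have hPd : P.IsDiff := (isDiff_posPart _).map _
  -- Left multiplication by `D` clears both `D⁻¹`; the remaining condition, zero residue, is the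
  -- adjoint linear problem.
  have hdiff : (N + Z).IsDiff := by
    refine isDiff_of_isDiff_D_one_mul ?_ ?_
    · rw [mul_add, D_one_mul_D_neg_one_mul, D_one_mul_D_neg_one_mul]
      exact (isDiff_ofFun _).add ((isDiff_ofFun _).mul hPd)
    · rw [res_add, hN, res_D_neg_one_mul_ofFun, hΨ, hW.flow_adjWaveFun, neg_add_cancel]
  have hpos : N + Z = Z.posPart := by
    rw [← hdiff.posPart_eq]
    ext k
    rw [coeff_posPart, coeff_posPart]
    split_ifs with hk
    · rw [coeff_add, hN, coeff_D_neg_one_mul_ofFun _ hk, zero_add]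
    · rfl
  have hW' := (hW.map isFlowHom_const).nabla_eq n
  have hnabla : nabla n (D (-1) * (ofFun Ψ * W.map const)) = Z.posPart * W.map const := by
    rw [← hpos, nabla_mul, nabla_mul, deriv_D, zero_mul, zero_add, deriv_ofFun, hW',
      ← laxPow_map isFlowHom_const, ← map_posPart, add_mul, mul_add]
    simp only [hN, hZ, mul_assoc]
    rfl
  rw [sep, flow_applyExp, hnabla, ← coeff_zero_mul_ofFun_applyExp]
  have hZmap : Z.map const = D (-1) * (ofFun (const Ψ) *
      ((laxPow W V n).map (const.comp const)).posPart) := by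
    rw [hZ, PDO.map_mul' isFlowHom_const, PDO.map_mul' isFlowHom_const, map_D, map_ofFun, hP,
      ← map_posPart]
    rfl
  rw [hZmap, res]
  simp only [← mul_assoc]
  -- The trailing `D⁻¹` turns the residue into the coefficient of `D⁰`.
  rw [coeff_mul_D]
  rfl

end SEP

end KP

end

noncomputable section

namespace KP

open PDO WaveRing

/-! ### Tau-function formulas, units and uniqueness in the iterated wave rings -/

section Tau

variable {A : Type*} [CommRing A] [Algebra ℚ A] [MultiTimeRing A] {W V : PDO A} {τ : Aˣ}

theorem waveFun_eq (hτ : IsTau W V τ) :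
    W.applyExp = ofPS (psShift (-1) (τ : A) * PowerSeries.C (↑τ⁻¹ : A)) * expXi 1 := by
  rw [map_mul, ofPS_C]
  exact hτ.wave

theorem adjWaveFun_eq (hτ : IsTau W V τ) :
    V.adjoint.applyExpNeg =
      ofPS (psShift 1 (τ : A) * PowerSeries.C (↑τ⁻¹ : A)) * expXi (-1) := by
  rw [map_mul, ofPS_C]
  exact hτ.adjWave

theorem symbolSeries_eq (hτ : IsTau W V τ) :
    symbolSeries W = psShift (-1) (τ : A) * PowerSeries.C (↑τ⁻¹ : A) := by
  have h := waveFun_eq hτ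
  rw [ofPS_mul_expXi, applyExp_eq_iff] at h
  ext i
  rw [symbolSeries, PowerSeries.coeff_mk, h, HahnSeries.ofPowerSeries_apply_coeff]

variable {A' : Type*} [CommRing A'] [Algebra ℚ A'] [MultiTimeRing A'] {φ : A →+* A'}

theorem waveFun_map (hτ : IsTau W V τ) (hφ : IsFlowHom φ) :
    waveFun (W.map φ) = shift (-1) (φ τ) * const (φ ↑τ⁻¹) * expXi 1 := by
  rw [waveFun, applyExp_map φ (waveFun_eq hτ), map_mul, hφ.map_psShift, PowerSeries.map_C,
    map_mul, ofPS_C, shift_eq_ofPS]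

theorem adjWaveFun_map (hτ : IsTau W V τ) (hφ : IsFlowHom φ) :
    adjWaveFun (V.map φ) = shift 1 (φ τ) * const (φ ↑τ⁻¹) * expXi (-1) := by
  rw [adjWaveFun, ← map_adjoint hφ, applyExpNeg_map φ (adjWaveFun_eq hτ), map_mul,
    hφ.map_psShift, PowerSeries.map_C, map_mul, ofPS_C, shift_eq_ofPS]

end Tau

section Terms

variable {B : Type*} [CommRing B]

theorem isUnit_expXi (k : ℤ) : IsUnit (expXi k : WaveRing B) :=
  IsUnit.of_mul_eq_one (expXi (-k)) (by rw [expXi_mul_expXi, add_neg_cancel, expXi_zero])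

theorem isUnit_spec (k : ℤ) : IsUnit (spec k : WaveRing B) :=
  IsUnit.of_mul_eq_one (spec (-k)) (spec_mul_spec_neg k)

/-- Elements `f(z) e^{kξ(t,z)}`. -/
def IsTerm (k : ℤ) (p : WaveRing B) : Prop := ∃ f, p = term k f

theorem IsTerm.mul {k l : ℤ} {p q : WaveRing B} (hp : IsTerm k p) (hq : IsTerm l q) :
    IsTerm (k + l) (p * q) := by
  obtain ⟨f, rfl⟩ := hp
  obtain ⟨g, rfl⟩ := hq
  exact ⟨_, term_mul_term k l f g⟩

theorem IsTerm.sub {k : ℤ} {p q : WaveRing B} (hp : IsTerm k p) (hq : IsTerm k q) :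
    IsTerm k (p - q) := by
  obtain ⟨f, rfl⟩ := hp
  obtain ⟨g, rfl⟩ := hq
  exact ⟨f + -g, by rw [term_add, term_neg, sub_eq_add_neg]⟩

theorem isTerm_ofPS (F : PowerSeries B) : IsTerm 0 (ofPS F) := ⟨_, rfl⟩

theorem isTerm_const (b : B) : IsTerm 0 (const b) := ⟨_, rfl⟩

theorem isTerm_expXi (k : ℤ) : IsTerm k (expXi k : WaveRing B) := ⟨1, rfl⟩

theorem isTerm_spec (k : ℤ) : IsTerm 0 (spec k : WaveRing B) := ⟨_, rfl⟩

end Terms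

section Shifts

variable {B : Type*} [CommRing B] [Algebra ℚ B] [MultiTimeRing B]

theorem shift_mul (ε : ℚ) (f g : B) : shift ε (f * g) = shift ε f * shift ε g := by
  simp only [shift_eq_ofPS, map_mul]

theorem shift_one (ε : ℚ) : shift ε (1 : B) = 1 := by
  rw [shift_eq_ofPS, map_one, map_one]

theorem shift_sub (ε : ℚ) (f g : B) : shift ε (f - g) = shift ε f - shift ε g := by
  simp only [shift_eq_ofPS, map_sub]

theorem shift_of_flow_eq_zero (ε : ℚ) {f : B} (h : ∀ n, flow n f = 0) : shift ε f = const f := by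
  rw [shift_eq_ofPS, psShift_of_flow_eq_zero ε h, ofPS_C]

/-- The factor `1 - μ λ⁻¹` of the shifted exponential, multiplied by `μ⁻¹` to involve only inverse
parameters; `μ` stands for the inner parameter and `λ` for the outer one. -/
theorem shift_expXi {ε : ℚ} {k : ℤ} (h : ε * k = -1) :
    const (spec (-1)) * shift ε (expXi k : WaveRing B) =
      const (expXi k) * (const (spec (-1)) - spec (-1)) := by
  have hs : (const (spec (-1)) * const (spec 1) : WaveRing (WaveRing B)) = 1 := by
    rw [← map_mul, mul_comm, spec_mul_spec_neg, map_one]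
  rw [shift_eq_ofPS, psShift_expXi h, map_mul, map_sub, map_mul, map_one, ofPS_C, ofPS_C, ofPS_X]
  linear_combination -const (expXi k) * spec (-1) * hs

theorem shift_const_expXi {ε : ℚ} {k : ℤ} (h : ε * k = -1) :
    const (const (spec (-1))) * shift ε (const (expXi k : WaveRing B)) =
      const (const (expXi k)) * (const (const (spec (-1))) - spec (-1)) := by
  have hs : (const (const (spec (-1))) * const (const (spec 1)) :
      WaveRing (WaveRing (WaveRing B))) = 1 := by
    rw [← map_mul, ← map_mul, mul_comm, spec_mul_spec_neg, map_one, map_one]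
  rw [shift_eq_ofPS, ← isFlowHom_const.map_psShift, psShift_expXi h]
  simp only [map_mul, map_sub, map_one, PowerSeries.map_C, PowerSeries.map_X, ofPS_C, ofPS_X]
  linear_combination -const (const (expXi k)) * spec (-1) * hs

/-- `μ⁻¹ - λ⁻¹` is invertible. -/
theorem isUnit_const_spec_sub_spec :
    IsUnit (const (spec (-1)) - spec (-1) : WaveRing (WaveRing B)) := by
  have h := shift_expXi (B := B) (ε := -1) (k := 1) (by norm_num)
  -- The geometric series in `μ/λ` need not be written down: up to unit factors the difference is a
  -- shift of the unit `e^ξ`, and shifts are ring homomorphisms.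
  refine isUnit_of_mul_isUnit_right (x := const (expXi 1)) ?_
  rw [← h]
  refine ((isUnit_spec (-1)).map const).mul ?_
  rw [shift_eq_ofPS]
  exact ((isUnit_expXi 1).map _).map ofPS

theorem IsTerm.eq_of_flow_eq {p q : WaveRing B} (hp : IsTerm 1 p) (hq : IsTerm 1 q)
    (h : flow 1 p = flow 1 q) : p = q := by
  obtain ⟨f, hf⟩ := hp.sub hq
  have h0 : flow 1 (term 1 f) = 0 := by rw [← hf, map_sub, h, sub_self]
  rw [eq_zero_of_flow_term h0] at hf
  refine sub_eq_zero.1 (hf.trans ?_)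
  exact AddMonoidAlgebra.single_zero _

end Shifts

section DoubleSeries

variable {A : Type*} [CommRing A]

/-- Double power series, inside `Ring2 A`. -/
def ofPS2 : PowerSeries (PowerSeries A) →+* Ring2 A := liftPS ofPS

theorem ofPS2_C (F : PowerSeries A) : ofPS2 (PowerSeries.C F) = const (ofPS F) := liftPS_C _ _

theorem ofPS2_X : ofPS2 (PowerSeries.X : PowerSeries (PowerSeries A)) = spec (-1) := liftPS_X _

end DoubleSeries

/-! ### Closed forms, and the reduction to Fay's identity -/

section Main

variable {A : Type*} [CommRing A] [Algebra ℚ A] [MultiTimeRing A] {W V : PDO A} {τ : Aˣ}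

theorem isFlowHom_ofPS2 : IsFlowHom (ofPS2 (A := A)) := isFlowHom_liftPS isFlowHom_ofPS

theorem ofPS2_psShift (ε : ℚ) (F : PowerSeries A) :
    ofPS2 (psShift ε F) = shift ε (ofPS F) := liftPS_psShift isFlowHom_ofPS ε F

/-- Fay's trisecant identity in `Ring3 A`. -/
theorem fay_ring3 (hW : IsDressing W V) (hτ : IsTau W V τ) :
    const (spec (-1)) * (const (const (spec (-1))) - spec (-1)) * toRing3 (τ : A) *
          shift (-1) (shift 1 (shift (-1) (τ : A))) -
        const (const (spec (-1))) * (const (spec (-1)) - spec (-1)) * shift (-1) (toRing2 (τ : A)) *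
          const (shift 1 (shift (-1) (τ : A))) =
      spec (-1) * (const (const (spec (-1))) - const (spec (-1))) *
        const (const (shift (-1) (τ : A))) * shift (-1) (shift 1 (const (τ : A))) := by
  have h := congrArg (liftPS ofPS2) (fay hW (symbolSeries_eq hτ))
  simp only [map_mul, map_sub, liftPS_C, liftPS_X, liftPS_psShift isFlowHom_ofPS2, ofPS2_C,
    ofPS2_X, ofPS2_psShift, ofPS_C, ofPS_X, ← shift_eq_ofPS] at h
  simp only [toRing3, toRing2, RingHom.comp_apply]
  exact h

/-- The differential Fay identity in `Ring3 A`. -/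
theorem differential_fay_ring3 (hW : IsDressing W V) (hτ : IsTau W V τ) :
    (const (spec (-1)) - spec (-1) : Ring3 A) *
        (const (shift 1 (const (τ : A))) * shift (-1) (toRing2 (τ : A)) -
          shift (-1) (shift 1 (const (τ : A))) * toRing3 (τ : A)) =
      const (spec (-1)) * spec (-1) *
        (flow 1 (shift (-1) (shift 1 (const (τ : A)))) * toRing3 (τ : A) -
          shift (-1) (shift 1 (const (τ : A))) * flow 1 (toRing3 (τ : A))) := by
  have hφ : IsFlowHom (liftPS (const (B := A))) := isFlowHom_liftPS isFlowHom_const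
  have h := congrArg (liftPS (liftPS (const (B := A)))) (differential_fay_inner hW (symbolSeries_eq hτ))
  simp only [map_mul, map_sub, liftPS_C, liftPS_X, liftPS_psShift hφ,
    liftPS_psShift isFlowHom_const, isFlowHom_liftPS hφ 1 _] at h
  simp only [toRing3, toRing2, RingHom.comp_apply]
  exact h

theorem isFlowHom_toRing2 : IsFlowHom (toRing2 (A := A)) := isFlowHom_const.comp isFlowHom_const

/-- `S(ψ(t,z), ψ*(t,λ))` in `Ring3 A`. -/
def waveSEP (W V : PDO A) : Ring3 A := sep (W.map const) (V.map const)

theorem flow_one_waveSEP (W V : PDO A) :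
    flow 1 (waveSEP W V) = const (psiStarLambda V) * psiZ W := flow_one_sep _ _

theorem isTerm_waveSEP (W V : PDO A) : IsTerm 1 (waveSEP W V) := ⟨_, rfl⟩

theorem isWaveSEP_waveSEP (hW : IsDressing W V) : IsWaveSEP W V (waveSEP W V) := by
  refine ⟨fun n => ?_, isTerm_waveSEP W V⟩
  have h := isSEP_sep (hW.map isFlowHom_const) n
  simp only [← laxPow_map isFlowHom_const] at h
  exact h

theorem IsWaveSEP.flow_one {S : Ring3 A} (hW : IsDressing W V) (hS : IsWaveSEP W V S) :
    flow 1 S = flow 1 (waveSEP W V) :=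
  (hS.1 1).trans ((isWaveSEP_waveSEP hW).1 1).symm

theorem IsWaveSEP.eq_waveSEP {S : Ring3 A} (hW : IsDressing W V) (hS : IsWaveSEP W V S) :
    S = waveSEP W V :=
  IsTerm.eq_of_flow_eq hS.2 (isTerm_waveSEP W V) (hS.flow_one hW)

/-- Associativity: `(ψ D⁻¹ ψ*) W = ψ (D⁻¹ ψ* W)`. -/
theorem ghostFlowOnWave_eq (W V : PDO A) :
    ghostFlowOnWave W V = const (psiMu W) * waveSEP W V := by
  rw [ghostFlowOnWave, ghostOp, waveSEP, sep, const_mul_applyExp, mul_assoc, mul_assoc]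
  rfl

/-- The closed form of the squared eigenfunction potential. -/
theorem waveSEP_eq (hW : IsDressing W V) (hτ : IsTau W V τ) :
    (const (spec (-1)) - spec (-1)) * waveSEP W V =
      const (spec (-1)) * spec (-1) * const (expXi (-1)) * toRing3 (↑τ⁻¹ : A) *
        shift (-1) (shift 1 (const (τ : A))) * expXi 1 := by
  have hT : toRing3 (τ : A) * toRing3 (↑τ⁻¹ : A) = 1 := by
    rw [← map_mul, Units.mul_inv, map_one]
  have hdT := congrArg (flow 1) hT
  rw [Derivation.leibniz, Derivation.map_one_eq_zero, smul_eq_mul, smul_eq_mul] at hdT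
  have hz : (spec (-1) * spec 1 : Ring3 A) = 1 := by
    rw [mul_comm, spec_mul_spec_neg]
  have hl : (const (spec (-1)) * const (spec 1) : Ring3 A) = 1 := by
    rw [← map_mul, mul_comm, spec_mul_spec_neg, map_one]
  have hX : ∀ k, flow 1 (const (spec k) : Ring3 A) = 0 := fun k => by
    rw [← isFlowHom_const, flow_spec, map_zero]
  have he : flow 1 (const (expXi (-1)) : Ring3 A) = -(const (spec 1) * const (expXi (-1))) := by
    rw [← isFlowHom_const, flow_expXi, neg_one_smul, map_neg, map_mul, PNat.one_coe, Nat.cast_one]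
  have he1 : flow 1 (expXi 1 : Ring3 A) = spec 1 * expXi 1 := by
    rw [flow_expXi, one_smul, PNat.one_coe, Nat.cast_one]
  -- Both sides are `e^{ξ(t,z)}` times a Laurent series in `z⁻¹`, so it suffices to compare
  -- `x`-derivatives.
  refine IsTerm.eq_of_flow_eq ?_ ?_ ?_
  · exact (((isTerm_const _).sub (isTerm_spec _)).mul (isTerm_waveSEP W V) :)
  · have h := (((((isTerm_const (spec (-1) : Ring2 A)).mul (isTerm_spec (-1))).mul
      (isTerm_const (expXi (-1)))).mul (isTerm_const (toRing2 (↑τ⁻¹ : A)))).mul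
      (isTerm_ofPS (psShift (-1) (shift 1 (const (τ : A)))))).mul (isTerm_expXi 1)
    exact h
  · have h := differential_fay_ring3 hW hτ
    have hψ : psiZ W = shift (-1) (toRing2 (τ : A)) * toRing3 (↑τ⁻¹ : A) * expXi 1 :=
      waveFun_map hτ isFlowHom_toRing2
    have hψs : (const (psiStarLambda V) : Ring3 A) =
        const (shift 1 (const (τ : A))) * toRing3 (↑τ⁻¹ : A) * const (expXi (-1)) := by
      rw [psiStarLambda, adjWaveFun_map hτ isFlowHom_const, map_mul, map_mul]
      rfl
    simp only [Derivation.leibniz, smul_eq_mul, map_sub, flow_one_waveSEP, hX, flow_spec, he, he1,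
      hψ, hψs]
    set T := toRing3 (τ : A)
    set Ti := toRing3 (↑τ⁻¹ : A)
    set q : Ring3 A := shift (-1) (shift 1 (const (τ : A)))
    set e : Ring3 A := expXi 1
    set e' : Ring3 A := const (expXi (-1))
    set z : Ring3 A := spec (-1)
    set l : Ring3 A := const (spec (-1))
    -- The exponentials contribute `z - λ`, and `λ⁻¹ z⁻¹ (z - λ) = λ⁻¹ - z⁻¹`; what remains is the
    -- differential Fay identity divided by `τ²`.
    linear_combination e * e' * Ti ^ 2 * h +
      e * e' * (l * z * (Ti * flow 1 q + q * flow 1 Ti) + (l - z) * Ti * q) * hT -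
      l * z * e' * e * q * Ti * hdT - Ti * e' * e * q * l * hz + Ti * e' * e * q * z * hl

/-- `e^{ξ(t + [λ⁻¹], μ)}` is the inverse of the shifted `e^{-ξ}`, whose factor `1 - μ/λ` is a
polynomial; multiplying by `μ⁻¹ - λ⁻¹` removes the resulting denominator. -/
theorem vertexOp_eq (f : A) :
    (const (spec (-1)) - spec (-1)) * vertexOp f =
      const (spec (-1)) * spec (-1) * const (expXi 1) * expXi (-1) * shift 1 (shift (-1) f) := by
  have h1 := shift_expXi (B := A) (ε := 1) (k := -1) (by norm_num)
  have h2 : shift 1 (expXi 1 : WaveRing A) * shift 1 (expXi (-1)) = 1 := by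
    rw [← shift_mul, expXi_mul_expXi, add_neg_cancel, expXi_zero, shift_one]
  have h3 : (const (expXi 1) * const (expXi (-1)) : Ring2 A) = 1 := by
    rw [← map_mul, expXi_mul_expXi, add_neg_cancel, expXi_zero, map_one]
  have h4 : (const (spec (-1)) - spec (-1)) * shift 1 (expXi 1 : WaveRing A) =
      const (spec (-1)) * const (expXi 1) := by
    linear_combination const (expXi 1) * const (spec (-1)) * h2 -
      const (expXi 1) * shift 1 (expXi 1 : WaveRing A) * h1 -
      (const (spec (-1)) - spec (-1)) * shift 1 (expXi 1 : WaveRing A) * h3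
  rw [vertexOp]
  linear_combination spec (-1) * expXi (-1) * shift 1 (shift (-1) f) * h4

theorem vertexActionOnWave_eq (hW : IsDressing W V) (hτ : IsTau W V τ) :
    vertexActionOnWave τ = const (psiMu W) * waveSEP W V := by
  have hu1 : IsUnit (const (const (spec (-1))) - const (spec (-1)) : Ring3 A) := by
    rw [← map_sub]
    exact isUnit_const_spec_sub_spec.map const
  have hu2 : IsUnit (const (spec (-1)) - spec (-1) : Ring3 A) := isUnit_const_spec_sub_spec
  refine (hu1.mul hu2).mul_left_cancel ?_
  have hv := congrArg const (vertexOp_eq (τ : A))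
  have hvs := congrArg (shift (-1)) (vertexOp_eq (τ : A))
  have hX1 : shift (-1) (const (spec (-1)) : Ring2 A) = const (const (spec (-1))) :=
    shift_of_flow_eq_zero _ fun n => by rw [← isFlowHom_const, flow_spec, map_zero]
  have hX2 : shift (-1) (spec (-1) : Ring2 A) = const (spec (-1)) :=
    shift_of_flow_eq_zero _ fun n => flow_spec n _
  have hμ := shift_const_expXi (B := A) (ε := -1) (k := 1) (by norm_num)
  have hl := shift_expXi (B := WaveRing A) (ε := -1) (k := 1) (by norm_num)
  have hll : shift (-1) (expXi 1 : Ring2 A) * shift (-1) (expXi (-1)) = 1 := by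
    rw [← shift_mul, expXi_mul_expXi, add_neg_cancel, expXi_zero, shift_one]
  have hee : (const (expXi 1) * const (expXi (-1)) : Ring3 A) = 1 := by
    rw [← map_mul, expXi_mul_expXi, add_neg_cancel, expXi_zero, map_one]
  have hS := waveSEP_eq hW hτ
  have hF := fay_ring3 hW hτ
  have hψ : (const (psiMu W) : Ring3 A) = const (const (shift (-1) (τ : A))) *
      toRing3 (↑τ⁻¹ : A) * const (const (expXi 1)) := by
    have hw : waveFun W = shift (-1) (τ : A) * const (↑τ⁻¹ : A) * expXi 1 := hτ.wave
    rw [psiMu, hw, map_mul, map_mul, map_mul, map_mul]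
    rfl
  simp only [map_mul, map_sub] at hv
  simp only [shift_mul, shift_sub, hX1, hX2] at hvs
  rw [hψ, vertexActionOnWave]
  generalize (const (const (spec (-1))) : Ring3 A) = X₁ at *
  generalize (const (spec (-1)) : Ring3 A) = X₂ at *
  generalize (spec (-1) : Ring3 A) = X₃ at *
  generalize (const (const (expXi 1)) : Ring3 A) = eM at *
  generalize (const (expXi 1) : Ring3 A) = eL at *
  generalize (const (expXi (-1)) : Ring3 A) = eL' at *
  generalize shift (-1) (const (expXi 1) : Ring2 A) = sM at *
  generalize shift (-1) (expXi 1 : Ring2 A) = sL at *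
  generalize shift (-1) (expXi (-1) : Ring2 A) = sL' at *
  generalize shift (-1) (vertexOp (τ : A)) = sv at *
  generalize (const (vertexOp (τ : A)) : Ring3 A) = v at *
  generalize shift (-1) (shift 1 (shift (-1) (τ : A))) = s₃ at *
  generalize (const (shift 1 (shift (-1) (τ : A))) : Ring3 A) = s₂ at *
  generalize shift (-1) (shift 1 (const (τ : A))) = q at *
  generalize shift (-1) (toRing2 (τ : A)) = tz at *
  generalize (const (const (shift (-1) (τ : A))) : Ring3 A) = tμ at *
  generalize toRing3 (τ : A) = T at *
  generalize toRing3 (↑τ⁻¹ : A) = Ti at *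
  generalize waveSEP W V = S at *
  generalize (expXi 1 : Ring3 A) = e at *
  -- The shift by `-[z⁻¹]` divides `e^{-ξ(t,λ)}` by `1 - λ/z`, again obtained by inverting the
  -- polynomial factor of `e^{ξ(t,λ)}`.
  have h6 : (X₂ - X₃) * sL' = X₂ * eL' := by
    linear_combination eL' * X₂ * hll - eL' * sL' * hl - sL' * (X₂ - X₃) * hee
  have h5 : (X₁ - X₂) * (X₂ - X₃) * sv = X₂ ^ 2 * eM * (X₁ - X₃) * eL' * s₃ := by
    linear_combination (X₂ - X₃) * hvs + X₂ * s₃ * sL' * (X₂ - X₃) * hμ +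
      X₂ * s₃ * eM * (X₁ - X₃) * h6
  -- With closed forms for `Xτ`, its shift and the potential substituted, the difference of the two
  -- sides is a multiple of the trisecant identity `hF`.
  linear_combination e * T * Ti ^ 2 * h5 - e * tz * Ti ^ 2 * (X₂ - X₃) * hv +
    e * Ti ^ 2 * eM * eL' * X₂ * hF - (X₁ - X₂) * tμ * Ti * eM * hS

end Main

end KP

end

theorem mainTheorem4 {A : Type*} [CommRing A] [Algebra ℚ A] [KP.MultiTimeRing A]
    (W V : KP.PDO A) (τ : Aˣ) (hW : KP.IsDressing W V) (hτ : KP.IsTau W V τ) :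
    (∃! S : KP.Ring3 A, KP.IsWaveSEP W V S) ∧
    (∀ S : KP.Ring3 A, KP.IsWaveSEP W V S →
      KP.vertexActionOnWave τ = KP.WaveRing.const (KP.psiMu W) * S) ∧
    KP.vertexActionOnWave τ = KP.ghostFlowOnWave W V := by
  have h := KP.vertexActionOnWave_eq hW hτ
  refine ⟨⟨KP.waveSEP W V, KP.isWaveSEP_waveSEP hW, fun S hS => hS.eq_waveSEP hW⟩,
    fun S hS => ?_, ?_⟩
  · rw [hS.eq_waveSEP hW, h]
  · rw [KP.ghostFlowOnWave_eq, h]
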